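/- Let $H$ be a separable (real or complex) Hilbert space, $B(H)$ the algebra of bounded linear operators on $H$ with the operator norm, and $GL(H)$ the group of its invertible elements. Let $G_1\subseteq G_2\subseteq\cdots$ be connected finite-dimensional Lie subgroups of $GL(H)$ (real Lie groups, immersed in $B(H)$), let $\mathfrak g_n\subseteq B(H)$ be the Lie algebra of $G_n$, and put $G_\infty=\bigcup_n G_n$, $\mathfrak g=\bigcup_n\mathfrak g_n$. Let $\mathfrak g_\infty$ be a real linear subspace of $B(H)$ with an inner product of its own, with norm $|\cdot|$, such that $\mathfrak g_\infty$ is complete with respect to $|\cdot|$, $\mathfrak g\subseteq\mathfrak g_\infty$, and $\mathfrak g$ is dense in $\mathfrak g_\infty$ in the norm $|\cdot|$. (A complex $\mathfrak g_\infty$ with a Hermitian inner product $(\cdot,\cdot)$ is covered by taking $\operatorname{Re}(\cdot,\cdot)$, which has the same norm.) Let $C^1_{CM}$ be the set of paths $g:[0,1]\to GL(H)$ that are continuous in the operator norm and for which, apart from finitely many points of $[0,1]$, the derivative $\dot g$ exists in the operator norm and $g^{-1}\dot g\in\mathfrak g_\infty$, where $\dot g$ is piecewise continuous in the operator norm and $g^{-1}\dot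 g$ is piecewise continuous in the norm $|\cdot|$. (Piecewise continuous means continuous apart from finitely many points, with one-sided limits everywhere.) For $y,z\in GL(H)$ let $$d(y,z)=\inf_g\int_0^1\left|g(s)^{-1}\dot g(s)\right|ds\in[0,\infty],$$ where $g$ runs over the paths in $C^1_{CM}$ with $g(0)=y$ and $g(1)=z$, and $\inf\emptyset=\infty$. Let $G_{CM}=\{x\in GL(H): d(x,I)<\infty\}$. Suppose that $\mathfrak g_\infty$ is closed under the commutator $[x,y]=xy-yx$ and that there is a constant $C>0$ such that $|[x,y]|\le C|x||y|$ for all $x,y\in\mathfrak g_\infty$. Then: 1. $G_\infty$ is a dense subset of $G_{CM}$ in $d$: $G_\infty\subseteq G_{CM}$, and for all $x\in G_{CM}$ and $\varepsilon>0$ there is $y\in G_\infty$ with $d(y,x)<\varepsilon$. 2. $G_{CM}$ is complete in $d$: every sequence in $G_{CM}$ that is Cauchy with respect to $d$ converges with respect to $d$ to an element of $G_{CM}$. -/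

import Mathlib

open Set Filter Topology MeasureTheory
open scoped Manifold ContDiff ENNReal

/-- A connected finite-dimensional (immersed) real Lie subgroup of the group `GL(H)` of invertible
bounded operators: a subgroup `carrier` of `GL(H)` together with a topology and a smooth atlas of
its own, for which it is a connected real Lie group of dimension `dim` and the inclusion into `B(H)`
is a smooth immersion. Embedded Lie subgroups are the special case in which the topology is induced
from the operator norm. -/
structure ConnectedLieSubgroup (𝕜 : Type*) [RCLike 𝕜] (H : Type*) [NormedAddCommGroup H]
    [InnerProductSpace 𝕜 H] [NormedSpace ℝ H] [IsScalarTower ℝ 𝕜 H] where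
  /-- the underlying subgroup of `GL(H)` -/
  carrier : Subgroup (H →L[𝕜] H)ˣ
  /-- the dimension -/
  dim : ℕ
  /-- the manifold topology, possibly finer than the operator norm topology -/
  [top : TopologicalSpace carrier]
  /-- the atlas -/
  [charts : ChartedSpace (EuclideanSpace ℝ (Fin dim)) carrier]
  [lieGroup : LieGroup (𝓡 dim) ∞ carrier]
  [connected : ConnectedSpace carrier]
  smooth_incl : ContMDiff (𝓡 dim) 𝓘(ℝ, H →L[𝕜] H) ∞
    (fun g : carrier => ((g : (H →L[𝕜] H)ˣ) : H →L[𝕜] H))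
  immersion : ∀ g : carrier, Function.Injective
    (mfderiv (𝓡 dim) 𝓘(ℝ, H →L[𝕜] H)
      (fun g : carrier => ((g : (H →L[𝕜] H)ˣ) : H →L[𝕜] H)) g)

namespace ConnectedLieSubgroup

variable {𝕜 : Type*} [RCLike 𝕜] {H : Type*} [NormedAddCommGroup H]
  [InnerProductSpace 𝕜 H] [NormedSpace ℝ H] [IsScalarTower ℝ 𝕜 H]

attribute [instance] top charts lieGroup connected

/-- The Lie algebra of a Lie subgroup of `GL(H)`, as a real subspace of `B(H)`: the image of the
tangent space at the identity under the differential of the inclusion. -/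
noncomputable def lieAlgebra (K : ConnectedLieSubgroup 𝕜 H) : Submodule ℝ (H →L[𝕜] H) :=
  LinearMap.range
    (mfderiv (𝓡 K.dim) 𝓘(ℝ, H →L[𝕜] H)
      (fun g : K.carrier => ((g : (H →L[𝕜] H)ˣ) : H →L[𝕜] H)) 1 :
        EuclideanSpace ℝ (Fin K.dim) →L[ℝ] (H →L[𝕜] H)).toLinearMap

end ConnectedLieSubgroup

/-- `f` is piecewise continuous on `[0,1]` with break points in the finite set `S`: it is continuous
at the points of `[0,1]` outside `S`, and it has all one-sided limits in `[0,1]`. The values at the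
points of `S` are irrelevant. -/
def PiecewiseContinuous {X : Type*} [TopologicalSpace X] (S : Finset ℝ) (f : ℝ → X) : Prop :=
  (∀ t ∈ Icc (0 : ℝ) 1, t ∉ S → ContinuousWithinAt f (Icc 0 1) t) ∧
  (∀ t ∈ Ioc (0 : ℝ) 1, ∃ l : X, Tendsto f (𝓝[<] t) (𝓝 l)) ∧
  (∀ t ∈ Ico (0 : ℝ) 1, ∃ r : X, Tendsto f (𝓝[>] t) (𝓝 r))

section CameronMartin

variable {𝕜 : Type*} [RCLike 𝕜] {H : Type*} [NormedAddCommGroup H]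
  [InnerProductSpace 𝕜 H] [NormedSpace ℝ H] [IsScalarTower ℝ 𝕜 H]
  {V : Type*} [NormedAddCommGroup V] [InnerProductSpace ℝ V]

/-- The path `g : [0,1] → GL(H)` belongs to `C¹_CM`, and `A` is its logarithmic derivative
`g' = g⁻¹ ġ`. The space `𝔤_∞ ⊆ B(H)` with its own inner product is given as an inner product space
`V` with an injective linear map `ι : V → B(H)` whose range is `𝔤_∞`. -/
structure IsCMPath (ι : V →ₗ[ℝ] (H →L[𝕜] H)) (g : ℝ → (H →L[𝕜] H)ˣ) (A : ℝ → V) : Prop where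
  /-- `g` is continuous in the operator norm -/
  continuousOn : ContinuousOn (fun t => (g t : H →L[𝕜] H)) (Icc 0 1)
  /-- apart from finitely many break points, `ġ` exists in the operator norm and `g⁻¹ ġ = A` lies in
  `𝔤_∞`; `ġ` is piecewise continuous in the operator norm, and `A` in the norm of `𝔤_∞` -/
  exists_deriv : ∃ (S : Finset ℝ) (dg : ℝ → (H →L[𝕜] H)),
    (∀ t ∈ Icc (0 : ℝ) 1, t ∉ S →
      HasDerivWithinAt (fun s => (g s : H →L[𝕜] H)) (dg t) (Icc 0 1) t) ∧
    PiecewiseContinuous S dg ∧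
    (∀ t ∈ Icc (0 : ℝ) 1, t ∉ S → ι (A t) = ((g t)⁻¹ : (H →L[𝕜] H)ˣ) * dg t) ∧
    PiecewiseContinuous S A

/-- `d(y,z)`: the infimum of the lengths `∫₀¹ |g⁻¹ ġ| ds` of the paths in `C¹_CM` from `y` to `z`;
it is `∞` if there are none. -/
noncomputable def cmDist (ι : V →ₗ[ℝ] (H →L[𝕜] H)) (y z : (H →L[𝕜] H)ˣ) : ℝ≥0∞ :=
  ⨅ (g : ℝ → (H →L[𝕜] H)ˣ) (A : ℝ → V) (_ : IsCMPath ι g A ∧ g 0 = y ∧ g 1 = z),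
    ∫⁻ t in Icc (0 : ℝ) 1, ‖A t‖ₑ

/-- The Cameron-Martin group `G_CM`: the operators at finite distance from the identity. (A path in
`C¹_CM` stays in `GL(H)`, so these operators are invertible.) -/
def cameronMartinGroup (ι : V →ₗ[ℝ] (H →L[𝕜] H)) : Set (H →L[𝕜] H)ˣ :=
  {x | cmDist ι x 1 < ⊤}

end CameronMartin

/-! The difficulty is that `ι` is not assumed continuous, so smallness in `V` says nothing about
operators. The remedy is a coarser notion than a path: `Reach N z ρ` allows controls in the closure
of the graph of `ι` in `V × B` and measures them by a seminorm `N`, either the norm of `V` alone or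
the full graph norm. Reachability is stable under products and inverses, and under conjugation by
`exp (ι v)`, because the bounded bracket makes `exp (ad v)` act on controls with bounded growth.

Conjugation drives the approximation. If a control `c` stays near a constant `v`, then correcting
the path by `exp (-(τ - x) v)` leaves a path with control `exp ((τ - x) ad v) (c - v)`, which is
small. Hence every reachable element is a product of exponentials up to an arbitrarily cheap
remainder (`Reach.exists_prodExp`). The exponents may be drawn from any family that is dense enough.

The distance and the `V`-cost of reaching agree up to a constant. A path is a reachable increment
(`reach_of_path`). Conversely, repeated approximation in the graph norm writes a reachable element
as an absolutely convergent product of exponentials, which smooth steps turn into a path of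
comparable length (`exists_path_of_tendsto`, `Reach.exists_hasPath`).

Density: choose the exponents in the Lie algebras, whose exponentials lie in the groups. The
inclusion of the groups follows from connectedness, since the reachable elements form an open
subgroup.

Completeness: by Baire (`exists_near_norm_ι_le`) every vector of `V` is a limit of vectors whose
images are bounded by a multiple of its norm. The increments of a rapidly Cauchy sequence are
therefore approximated by products of exponentials with summable graph norms, and these converge to
an invertible operator (`exists_limit`). -/

set_option linter.unusedSectionVars false

/-! ### Exponentials and the adjoint action in a Banach algebra -/

section ExpUnit

variable {B : Type*} [NormedRing B] [NormedAlgebra ℝ B] [CompleteSpace B]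

theorem exp_mul_exp_neg_self (X : B) : NormedSpace.exp X * NormedSpace.exp (-X) = 1 := by
  let _ : NormedAlgebra ℚ B := NormedAlgebra.restrictScalars ℚ ℝ B
  rw [← NormedSpace.exp_add_of_commute (Commute.neg_right (Commute.refl X)), add_neg_cancel,
    NormedSpace.exp_zero]

/-- The exponential of `X` as an invertible element. -/
noncomputable def expUnit (X : B) : Bˣ where
  val := NormedSpace.exp X
  inv := NormedSpace.exp (-X)
  val_inv := exp_mul_exp_neg_self X
  inv_val := by simpa using exp_mul_exp_neg_self (-X)

theorem coe_expUnit (X : B) : (expUnit X : B) = NormedSpace.exp X := rfl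

theorem coe_expUnit_inv (X : B) : (((expUnit X)⁻¹ : Bˣ) : B) = NormedSpace.exp (-X) := rfl

theorem expUnit_zero : expUnit (0 : B) = 1 := by
  ext; simp [coe_expUnit, NormedSpace.exp_zero]

theorem expUnit_neg (X : B) : expUnit (-X) = (expUnit X)⁻¹ := by
  ext; rfl

theorem expUnit_nsmul (n : ℕ) (X : B) : expUnit (n • X) = expUnit X ^ n := by
  let _ : NormedAlgebra ℚ B := NormedAlgebra.restrictScalars ℚ ℝ B
  ext
  rw [coe_expUnit, NormedSpace.exp_nsmul, Units.val_pow_eq_pow_val, coe_expUnit]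

theorem hasDerivAt_expUnit_smul (X : B) (t : ℝ) :
    HasDerivAt (fun s : ℝ => (expUnit (s • X) : B)) (expUnit (t • X) * X) t :=
  hasDerivAt_exp_smul_const X t

/-- The exponential of a bounded operator. -/
noncomputable def expL {E : Type*} [NormedAddCommGroup E] [NormedSpace ℝ E] (T : E →L[ℝ] E) :
    E →L[ℝ] E := NormedSpace.exp T

theorem expL_zero {E : Type*} [NormedAddCommGroup E] [NormedSpace ℝ E] (y : E) :
    expL (0 : E →L[ℝ] E) y = y := by
  rw [expL, NormedSpace.exp_zero]; rfl

theorem hasSum_exp_apply {E : Type*} [NormedAddCommGroup E] [NormedSpace ℝ E] [CompleteSpace E]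
    (T : E →L[ℝ] E) (y : E) :
    HasSum (fun n : ℕ => ((n.factorial : ℝ)⁻¹) • (T ^ n) y) (expL T y) := by
  have h := NormedSpace.exp_series_hasSum_exp' (𝕂 := ℝ) T
  exact h.mapL (ContinuousLinearMap.apply ℝ E y)

/-- A closed subspace invariant under `T` is invariant under `exp T`, and a continuous seminorm on
it grows at most by the factor `exp M` if `M` bounds `T`. -/
theorem exp_apply_mem_and_seminorm_le {E : Type*} [NormedAddCommGroup E] [NormedSpace ℝ E]
    [CompleteSpace E] (T : E →L[ℝ] E) {Γ : Submodule ℝ E} (hΓ : IsClosed (Γ : Set E))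
    (N : Seminorm ℝ E) (hN : Continuous N) {M : ℝ} (hT : ∀ y ∈ Γ, T y ∈ Γ)
    (hM : ∀ y ∈ Γ, N (T y) ≤ M * N y) (hM0 : 0 ≤ M) {y : E} (hy : y ∈ Γ) :
    expL T y ∈ Γ ∧ N (expL T y) ≤ Real.exp M * N y := by
  have hs := hasSum_exp_apply T y
  have hmem : ∀ n : ℕ, (T ^ n) y ∈ Γ ∧ N ((T ^ n) y) ≤ M ^ n * N y := by
    intro n
    induction n with
    | zero => simpa using hy
    | succ n ih =>
      rw [pow_succ']
      refine ⟨hT _ ih.1, (hM _ ih.1).trans ?_⟩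
      rw [pow_succ', mul_assoc]
      exact mul_le_mul_of_nonneg_left ih.2 hM0
  refine ⟨hΓ.mem_of_tendsto hs (Eventually.of_forall fun s =>
    Γ.sum_mem fun n _ => Γ.smul_mem _ (hmem n).1), ?_⟩
  have hlim : Tendsto (fun s : Finset ℕ => N (∑ n ∈ s, ((n.factorial : ℝ)⁻¹) • (T ^ n) y)) atTop
      (𝓝 (N (expL T y))) := (hN.tendsto _).comp hs
  refine le_of_tendsto hlim (Eventually.of_forall fun s => ?_)
  have hexp : HasSum (fun n : ℕ => M ^ n / n.factorial) (Real.exp M) := by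
    rw [Real.exp_eq_exp_ℝ]
    exact NormedSpace.expSeries_div_hasSum_exp M
  calc N (∑ n ∈ s, ((n.factorial : ℝ)⁻¹) • (T ^ n) y)
      ≤ ∑ n ∈ s, N (((n.factorial : ℝ)⁻¹) • (T ^ n) y) :=
        Finset.le_sum_of_subadditive N (map_zero N).le (map_add_le_add N) _ _
    _ ≤ ∑ n ∈ s, (M ^ n / n.factorial) * N y := by
        refine Finset.sum_le_sum fun n _ => ?_
        rw [map_smul_eq_mul, Real.norm_of_nonneg (by positivity), div_mul_eq_mul_div, div_eq_inv_mul]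
        exact mul_le_mul_of_nonneg_left (hmem n).2 (by positivity)
    _ = (∑ n ∈ s, (M ^ n / n.factorial)) * N y := by rw [Finset.sum_mul]
    _ ≤ Real.exp M * N y := by
        refine mul_le_mul_of_nonneg_right ?_ (apply_nonneg N y)
        exact sum_le_hasSum s (fun n _ => by positivity) hexp

/-- Left minus right multiplication by `X`. -/
noncomputable def adL (X : B) : B →L[ℝ] B :=
  ContinuousLinearMap.mul ℝ B X - (ContinuousLinearMap.mul ℝ B).flip X

theorem adL_apply (X b : B) : adL X b = X * b - b * X := rfl

theorem adL_smul (r : ℝ) (X : B) : adL (r • X) = r • adL X := by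
  ext b; simp [adL_apply, smul_sub]

theorem hasDerivAt_exp_smul_apply {E : Type*} [NormedAddCommGroup E] [NormedSpace ℝ E]
    [CompleteSpace E] (T : E →L[ℝ] E) (y : E) (t : ℝ) :
    HasDerivAt (fun s : ℝ => expL (s • T) y) (T (expL (t • T) y)) t := by
  have h := hasDerivAt_exp_smul_const' T t
  exact (ContinuousLinearMap.apply ℝ E y).hasFDerivAt.comp_hasDerivAt t h

theorem continuous_expL_smul {E : Type*} [NormedAddCommGroup E] [NormedSpace ℝ E]
    [CompleteSpace E] (T : E →L[ℝ] E) : Continuous fun s : ℝ => expL (s • T) :=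
  continuous_iff_continuousAt.2 fun t => (hasDerivAt_exp_smul_const' T t).continuousAt

/-- Conjugating `exp (s ad X) b` back by `exp (-s X)` gives a curve with zero derivative, so it
keeps its initial value `b`. -/
theorem exp_adL_apply (X b : B) :
    expL (adL X) b = expUnit X * b * ((expUnit X)⁻¹ : Bˣ) := by
  set f : ℝ → B := fun s => ((NormedSpace.exp (s • (-X))) * expL (s • adL X) b) *
    NormedSpace.exp (s • X) with hf
  have hd : ∀ t, HasDerivAt f 0 t := by
    intro t
    have h1 := hasDerivAt_exp_smul_const (-X) t
    have h2 := hasDerivAt_exp_smul_apply (adL X) b t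
    have h3 := hasDerivAt_exp_smul_const' X t
    refine ((h1.mul h2).mul h3).congr_deriv ?_
    rw [adL_apply, Pi.mul_apply]
    noncomm_ring
  have hc : f 1 = f 0 := is_const_of_deriv_eq_zero (fun t => (hd t).differentiableAt)
    (fun t => (hd t).deriv) 1 0
  have h00 : (0 : ℝ) • adL X = 0 := ContinuousLinearMap.ext fun _ => zero_smul ℝ _
  have h0 : f 0 = b := by simp only [hf, h00, expL_zero]; simp [NormedSpace.exp_zero]
  rw [h0] at hc
  have h1 : f 1 = (((expUnit X)⁻¹ : Bˣ) : B) * expL (adL X) b * expUnit X := by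
    simp [hf, coe_expUnit, coe_expUnit_inv]
  rw [h1] at hc
  nth_rw 2 [← hc]
  simp [mul_assoc]

end ExpUnit

/-! ### The closed graph of the realization and its adjoint action -/

/-- A normed Lie algebra `V` with continuous bracket, realized as a space of elements of a Banach
algebra `B` by a linear map `ι` that need not be continuous. -/
structure LieRealization (V B : Type*) [NormedAddCommGroup V] [NormedSpace ℝ V] [NormedRing B]
    [NormedAlgebra ℝ B] where
  /-- the realization -/
  ι : V →ₗ[ℝ] B
  /-- the adjoint action -/
  ad : V →ₗ[ℝ] (V →L[ℝ] V)
  /-- a bound for the bracket -/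
  C : ℝ
  C_nonneg : 0 ≤ C
  ι_ad : ∀ x y, ι (ad x y) = ι x * ι y - ι y * ι x
  norm_ad_le : ∀ x y, ‖ad x y‖ ≤ C * ‖x‖ * ‖y‖

namespace LieRealization

variable {V B : Type*} [NormedAddCommGroup V] [NormedSpace ℝ V] [CompleteSpace V]
  [NormedRing B] [NormedAlgebra ℝ B] [CompleteSpace B] (D : LieRealization V B)

/-- The point of the graph of `ι` over `v`. -/
noncomputable def pt : V →ₗ[ℝ] V × B := LinearMap.prod LinearMap.id D.ι

theorem pt_fst (v : V) : (D.pt v).1 = v := rfl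

theorem pt_snd (v : V) : (D.pt v).2 = D.ι v := rfl

/-- The closure of the graph of `ι`. -/
noncomputable def graphClosure : Submodule ℝ (V × B) := (LinearMap.range D.pt).topologicalClosure

theorem isClosed_graphClosure : IsClosed (D.graphClosure : Set (V × B)) :=
  Submodule.isClosed_topologicalClosure _

theorem pt_mem (v : V) : D.pt v ∈ D.graphClosure :=
  Submodule.le_topologicalClosure _ (LinearMap.mem_range_self _ v)

theorem exists_pt_near {c : V × B} (hc : c ∈ D.graphClosure) {η : ℝ} (hη : 0 < η) :
    ∃ v, ‖c - D.pt v‖ ≤ η := by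
  have h : c ∈ closure (LinearMap.range D.pt : Set (V × B)) := hc
  obtain ⟨_, ⟨v, rfl⟩, hv⟩ := Metric.mem_closure_iff.1 h η hη
  exact ⟨v, by rw [← dist_eq_norm]; exact hv.le⟩

/-- The adjoint action of `V` on `V × B`. -/
noncomputable def adE (v : V) : V × B →L[ℝ] V × B := (D.ad v).prodMap (adL (D.ι v))

theorem adE_apply (v : V) (c : V × B) :
    D.adE v c = (D.ad v c.1, D.ι v * c.2 - c.2 * D.ι v) := rfl

theorem adE_smul (r : ℝ) (v : V) : D.adE (r • v) = r • D.adE v := by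
  ext c <;> simp [adE, adL_smul]

/-- The graph itself is invariant because `ι` respects brackets; `adE v` is continuous on `V × B`
even when `ι` is not, so invariance passes to the closure. -/
theorem adE_mem (v : V) {c : V × B} (hc : c ∈ D.graphClosure) : D.adE v c ∈ D.graphClosure := by
  have h : MapsTo (D.adE v) (LinearMap.range D.pt : Set (V × B))
      (LinearMap.range D.pt : Set (V × B)) := by
    rintro _ ⟨x, rfl⟩
    refine ⟨D.ad v x, ?_⟩
    rw [adE_apply]
    exact Prod.ext rfl (D.ι_ad v x)
  exact h.closure (D.adE v).continuous hc

/-- This identifies the abstract flow on controls with genuine conjugation of operators, so a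
conjugated path has the control transported by `exp (adE v)`. -/
theorem snd_exp_adE (v : V) (c : V × B) :
    (expL (D.adE v) c).2 = expUnit (D.ι v) * c.2 * ((expUnit (D.ι v))⁻¹ : Bˣ) := by
  rw [← exp_adL_apply]
  have h1 := (hasSum_exp_apply (D.adE v) c).mapL (ContinuousLinearMap.snd ℝ V B)
  have h2 := hasSum_exp_apply (adL (D.ι v)) c.2
  refine h1.unique ?_
  have this : ∀ n : ℕ, ((D.adE v ^ n) c).2 = (adL (D.ι v) ^ n) c.2 := by
    intro n
    induction n with
    | zero => rfl
    | succ n ih =>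
      rw [pow_succ', pow_succ']
      change (D.adE v ((D.adE v ^ n) c)).2 = adL (D.ι v) ((adL (D.ι v) ^ n) c.2)
      rw [← ih]; rfl
  have heq : (fun n : ℕ => ((n.factorial : ℝ)⁻¹) • (adL (D.ι v) ^ n) c.2) =
      fun n : ℕ => ContinuousLinearMap.snd ℝ V B (((n.factorial : ℝ)⁻¹) • (D.adE v ^ n) c) := by
    funext n
    rw [← this]; rfl
  exact heq ▸ h2

/-- A continuous seminorm on `V × B` for which the adjoint action is bounded. -/
structure AdBounded (N : Seminorm ℝ (V × B)) (κ : ℝ) : Prop where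
  continuous : Continuous N
  nonneg : 0 ≤ κ
  le : ∀ v, ∀ c ∈ D.graphClosure, N (D.adE v c) ≤ κ * N (D.pt v) * N c

/-- The norm of `V` as a seminorm on `V × B`. -/
noncomputable def fstSeminorm (V B : Type*) [NormedAddCommGroup V] [NormedSpace ℝ V] [NormedRing B]
    [NormedAlgebra ℝ B] : Seminorm ℝ (V × B) :=
  (normSeminorm ℝ V).comp (LinearMap.fst ℝ V B)

theorem fstSeminorm_apply (c : V × B) : fstSeminorm V B c = ‖c.1‖ := rfl

theorem adBounded_fst : D.AdBounded (fstSeminorm V B) D.C where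
  continuous := continuous_fst.norm
  nonneg := D.C_nonneg
  le v c _ := D.norm_ad_le v c.1

theorem adBounded_norm : D.AdBounded (normSeminorm ℝ (V × B)) (D.C + 2) where
  continuous := continuous_norm
  nonneg := by linarith [D.C_nonneg]
  le v c _ := by
    simp only [coe_normSeminorm]
    have h1 : ‖v‖ ≤ ‖D.pt v‖ := norm_fst_le (D.pt v)
    have h2 : ‖D.ι v‖ ≤ ‖D.pt v‖ := norm_snd_le (D.pt v)
    have h3 : ‖c.1‖ ≤ ‖c‖ := norm_fst_le c
    have h4 : ‖c.2‖ ≤ ‖c‖ := norm_snd_le c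
    have h5 : 0 ≤ ‖D.pt v‖ * ‖c‖ := by positivity
    have h6 := D.C_nonneg
    rw [adE_apply, Prod.norm_def]
    refine max_le ((D.norm_ad_le _ _).trans ?_) ((norm_sub_le _ _).trans ?_)
    · rw [mul_assoc, mul_assoc]
      have : ‖v‖ * ‖c.1‖ ≤ ‖D.pt v‖ * ‖c‖ := by gcongr
      nlinarith
    · have e1 : ‖D.ι v * c.2‖ ≤ ‖D.pt v‖ * ‖c‖ := (norm_mul_le _ _).trans (by gcongr)
      have e2 : ‖c.2 * D.ι v‖ ≤ ‖D.pt v‖ * ‖c‖ := by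
        rw [mul_comm ‖D.pt v‖]; exact (norm_mul_le _ _).trans (by gcongr)
      rw [mul_assoc]
      nlinarith

variable {D} in
theorem AdBounded.exp_adE {N : Seminorm ℝ (V × B)} {κ : ℝ} (h : D.AdBounded N κ) (v : V)
    {c : V × B} (hc : c ∈ D.graphClosure) :
    expL (D.adE v) c ∈ D.graphClosure ∧
      N (expL (D.adE v) c) ≤ Real.exp (κ * N (D.pt v)) * N c :=
  exp_apply_mem_and_seminorm_le _ D.isClosed_graphClosure N h.continuous
    (fun _ hy => D.adE_mem v hy) (h.le v) (mul_nonneg h.nonneg (apply_nonneg _ _)) hc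

end LieRealization

/-- A relation between points of `[a, b]` that is transitive and holds near each point, on both
sides, holds between `a` and `b`. -/
theorem interval_induction {Q : ℝ → ℝ → Prop} {a b : ℝ} (hab : a ≤ b)
    (hloc : ∀ x ∈ Icc a b, ∃ h > 0, (∀ y ∈ Icc a b, x ≤ y → y < x + h → Q x y) ∧
      ∀ y ∈ Icc a b, x - h < y → y ≤ x → Q y x)
    (htrans : ∀ x y z, a ≤ x → x ≤ y → y ≤ z → z ≤ b → Q x y → Q y z → Q x z) : Q a b := by
  set T : Set ℝ := {y | y ∈ Icc a b ∧ Q a y} with hT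
  have haT : a ∈ T := by
    obtain ⟨h, hh, h1, -⟩ := hloc a ⟨le_rfl, hab⟩
    exact ⟨⟨le_rfl, hab⟩, h1 a ⟨le_rfl, hab⟩ le_rfl (by linarith)⟩
  have hbdd : BddAbove T := ⟨b, fun y hy => hy.1.2⟩
  set c := sSup T with hc
  have hac : a ≤ c := le_csSup hbdd haT
  have hcb : c ≤ b := csSup_le ⟨a, haT⟩ fun y hy => hy.1.2
  obtain ⟨h, hh, h1, h2⟩ := hloc c ⟨hac, hcb⟩
  obtain ⟨y, hyT, hy⟩ := exists_lt_of_lt_csSup ⟨a, haT⟩ (show c - h < sSup T by linarith)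
  have hyc : y ≤ c := le_csSup hbdd hyT
  have hQc : Q a c := htrans a y c le_rfl hyT.1.1 hyc hcb hyT.2 (h2 y hyT.1 hy hyc)
  rcases hcb.eq_or_lt with heq | hlt
  · rwa [heq] at hQc
  · exfalso
    obtain ⟨z, hz1, hz2⟩ := exists_between (show c < min b (c + h) from
      lt_min hlt (by linarith))
    have hzb : z ≤ b := (hz2.trans_le (min_le_left _ _)).le
    have hzT : z ∈ T := ⟨⟨hac.trans hz1.le, hzb⟩, htrans a c z le_rfl hac hz1.le hzb hQc
      (h1 z ⟨hac.trans hz1.le, hzb⟩ hz1.le (hz2.trans_le (min_le_right _ _)))⟩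
    exact absurd (le_csSup hbdd hzT) (not_le.2 hz1)

/-! ### Reachable elements and their cost -/

namespace LieRealization

variable {V B : Type*} [NormedAddCommGroup V] [NormedSpace ℝ V] [CompleteSpace V]
  [NormedRing B] [NormedAlgebra ℝ B] [CompleteSpace B] (D : LieRealization V B)

/-- A path `p` of invertible elements on `[s, t]` whose logarithmic derivative is the `B`-component
of a continuous path `c` in the closure of the graph of `ι`, with `N c ≤ K`. -/
structure IsSegment (N : Seminorm ℝ (V × B)) (K s t : ℝ) (p : ℝ → Bˣ) (c : ℝ → V × B) : Prop where
  cont_path : ContinuousOn (fun τ => (p τ : B)) (Icc s t)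
  cont_control : ContinuousOn c (Icc s t)
  mem : ∀ τ ∈ Icc s t, c τ ∈ D.graphClosure
  bound : ∀ τ ∈ Icc s t, N (c τ) ≤ K
  deriv : ∀ τ ∈ Ioo s t, HasDerivAt (fun τ => (p τ : B)) (p τ * (c τ).2) τ

/-- `z` is a product of increments `p(s)⁻¹ p(t)` of segments of total length at most `ρ`. -/
inductive Reach (N : Seminorm ℝ (V × B)) : Bˣ → ℝ → Prop
  | seg {K s t : ℝ} {p : ℝ → Bˣ} {c : ℝ → V × B} (hst : s ≤ t) (h : D.IsSegment N K s t p c) :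
      Reach N ((p s)⁻¹ * p t) (K * (t - s))
  | mul {z z' : Bˣ} {ρ ρ' : ℝ} (h : Reach N z ρ) (h' : Reach N z' ρ') : Reach N (z * z') (ρ + ρ')
  | mono {z : Bˣ} {ρ ρ' : ℝ} (h : Reach N z ρ) (hle : ρ ≤ ρ') : Reach N z ρ'

variable {D} {N : Seminorm ℝ (V × B)}

theorem IsSegment.nonneg {K s t : ℝ} {p : ℝ → Bˣ} {c : ℝ → V × B} (h : D.IsSegment N K s t p c)
    (hst : s ≤ t) : 0 ≤ K :=
  (apply_nonneg N _).trans (h.bound s ⟨le_rfl, hst⟩)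

theorem Reach.nonneg {z : Bˣ} {ρ : ℝ} (h : D.Reach N z ρ) : 0 ≤ ρ := by
  induction h with
  | seg hst h => exact mul_nonneg (h.nonneg hst) (sub_nonneg.2 hst)
  | mul _ _ h h' => exact add_nonneg h h'
  | mono _ hle h => exact h.trans hle

theorem reach_one {ρ : ℝ} (hρ : 0 ≤ ρ) : D.Reach N 1 ρ := by
  have h : D.IsSegment N 0 0 0 (fun _ => 1) fun _ => 0 :=
    ⟨continuousOn_const, continuousOn_const, fun _ _ => zero_mem _, fun _ _ => by simp,
      fun τ hτ => absurd (hτ.1.trans hτ.2) (lt_irrefl _)⟩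
  have h' := Reach.seg le_rfl h
  simp only [inv_one, mul_one] at h'
  exact h'.mono (by simpa using hρ)

/-- Run each segment backwards, which negates its control. -/
theorem Reach.inv {z : Bˣ} {ρ : ℝ} (h : D.Reach N z ρ) : D.Reach N z⁻¹ ρ := by
  induction h with
  | @seg K s t p c hst h =>
    have hmaps : MapsTo (fun τ : ℝ => -τ) (Icc (-t) (-s)) (Icc s t) := fun τ hτ =>
      ⟨by linarith [hτ.2], by linarith [hτ.1]⟩
    have h' : D.IsSegment N K (-t) (-s) (fun τ => p (-τ)) fun τ => -c (-τ) :=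
      { cont_path := h.cont_path.comp continuous_neg.continuousOn hmaps
        cont_control := (h.cont_control.comp continuous_neg.continuousOn hmaps).neg
        mem := fun τ hτ => neg_mem (h.mem _ (hmaps hτ))
        bound := fun τ hτ => by rw [map_neg_eq_map]; exact h.bound _ (hmaps hτ)
        deriv := fun τ hτ => by
          have hd := h.deriv (-τ) ⟨by linarith [hτ.2], by linarith [hτ.1]⟩
          refine (hd.scomp τ (hasDerivAt_neg τ)).congr_deriv ?_
          simp }
    have := Reach.seg (neg_le_neg hst) h'
    simp only [neg_neg] at this
    rw [mul_inv_rev, inv_inv]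
    exact this.mono (by linarith)
  | mul _ _ h h' => rw [mul_inv_rev, add_comm]; exact h'.mul h
  | mono _ hle h => exact h.mono hle

/-- With `e = exp (ι v)`, the path `p e⁻¹` has control `Ad(e) c`, and its increment is the conjugate
of the increment of `p`. -/
theorem Reach.conj {κ : ℝ} (hN : D.AdBounded N κ) (v : V) {z : Bˣ} {ρ : ℝ} (h : D.Reach N z ρ) :
    D.Reach N (expUnit (D.ι v) * z * (expUnit (D.ι v))⁻¹) (Real.exp (κ * N (D.pt v)) * ρ) := by
  set e := expUnit (D.ι v) with he
  induction h with
  | @seg K s t p c hst h =>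
    have h' : D.IsSegment N (Real.exp (κ * N (D.pt v)) * K) s t (fun τ => p τ * e⁻¹)
        fun τ => expL (D.adE v) (c τ) :=
      { cont_path := by
          simp only [Units.val_mul]
          exact h.cont_path.mul continuousOn_const
        cont_control := (expL (D.adE v)).continuous.comp_continuousOn h.cont_control
        mem := fun τ hτ => (hN.exp_adE v (h.mem τ hτ)).1
        bound := fun τ hτ => (hN.exp_adE v (h.mem τ hτ)).2.trans
          (mul_le_mul_of_nonneg_left (h.bound τ hτ) (Real.exp_pos _).le)
        deriv := fun τ hτ => by
          simp only [Units.val_mul]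
          refine ((h.deriv τ hτ).mul_const _).congr_deriv ?_
          rw [snd_exp_adE, ← he]
          simp [mul_assoc] }
    have := Reach.seg hst h'
    have hz : e * ((p s)⁻¹ * p t) * e⁻¹ = (p s * e⁻¹)⁻¹ * (p t * e⁻¹) := by group
    rw [hz]
    exact this.mono (by rw [mul_assoc])
  | @mul z z' ρ ρ' _ _ h h' =>
    have hz : e * (z * z') * e⁻¹ = (e * z * e⁻¹) * (e * z' * e⁻¹) := by group
    rw [hz, mul_add]
    exact h.mul h'
  | mono _ hle h => exact h.mono (mul_le_mul_of_nonneg_left hle (Real.exp_pos _).le)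

/-- Grönwall for `f = p(s)⁻¹ p - 1`, which solves `f' = f c + c` with `f(s) = 0`. Subtracting `1`
first keeps `‖1‖` out of the bound, which then composes under products. -/
theorem IsSegment.norm_sub_one_le {K s t : ℝ} {p : ℝ → Bˣ} {c : ℝ → V × B} (hst : s ≤ t)
    (h : D.IsSegment (normSeminorm ℝ (V × B)) K s t p c) :
    ‖(((p s)⁻¹ * p t : Bˣ) : B) - 1‖ ≤ Real.exp (K * (t - s)) - 1 := by
  rcases hst.eq_or_lt with rfl | hlt
  · simp
  have hK := h.nonneg hst
  set f : ℝ → B := fun τ => (((p s)⁻¹ : Bˣ) : B) * p τ - 1 with hf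
  set f' : ℝ → B := fun τ => ((((p s)⁻¹ : Bˣ) : B) * p τ) * (c τ).2 with hf'
  have hfc : ContinuousOn f (Icc s t) := (continuousOn_const.mul h.cont_path).sub continuousOn_const
  have hfd : ∀ τ ∈ Ioo s t, HasDerivAt f (f' τ) τ := fun τ hτ => by
    refine (((h.deriv τ hτ).const_mul _).sub_const _).congr_deriv ?_
    simp [hf', mul_assoc]
  have hf'c : ContinuousOn f' (Icc s t) :=
    (continuousOn_const.mul h.cont_path).mul (continuous_snd.comp_continuousOn h.cont_control)
  have hder : ∀ τ ∈ Ico s t, HasDerivWithinAt f (f' τ) (Ici τ) τ := by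
    intro τ hτ
    rcases hτ.1.eq_or_lt with rfl | hτs
    -- The equation is given only in the open interval; at the left end the right derivative is the
    -- limit of the derivatives, since the control is continuous there.
    · refine hasDerivWithinAt_Ici_of_tendsto_deriv (s := Ioo s t)
        (fun x hx => (hfd x hx).differentiableAt.differentiableWithinAt)
        ((hfc s ⟨le_rfl, hst⟩).mono Ioo_subset_Icc_self) (Ioo_mem_nhdsGT hlt) ?_
      have h1 : Tendsto f' (𝓝[>] s) (𝓝 (f' s)) := by
        have := (hf'c s ⟨le_rfl, hst⟩).mono Ioo_subset_Icc_self
        rwa [ContinuousWithinAt, nhdsWithin_Ioo_eq_nhdsGT hlt] at this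
      refine h1.congr' ?_
      filter_upwards [Ioo_mem_nhdsGT hlt] with x hx using (hfd x hx).deriv.symm
    · exact (hfd τ ⟨hτs, hτ.2⟩).hasDerivWithinAt
  have hbound : ∀ τ ∈ Ico s t, ‖f' τ‖ ≤ K * ‖f τ‖ + K := by
    intro τ hτ
    have hc : ‖(c τ).2‖ ≤ K := (norm_snd_le _).trans (h.bound τ ⟨hτ.1, hτ.2.le⟩)
    have : f' τ = f τ * (c τ).2 + (c τ).2 := by simp [hf, hf', sub_mul]
    rw [this, mul_comm K]
    exact (norm_add_le _ _).trans (add_le_add ((norm_mul_le _ _).trans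
      (mul_le_mul_of_nonneg_left hc (norm_nonneg _))) hc)
  have h0 : ‖f s‖ ≤ 0 := by simp [hf]
  have := norm_le_gronwallBound_of_norm_deriv_right_le hfc hder h0 hbound t ⟨hst, le_rfl⟩
  rw [Units.val_mul]
  refine this.trans (le_of_eq ?_)
  rcases hK.eq_or_lt with hK0 | hK0
  · simp [← hK0, gronwallBound]
  · rw [gronwallBound_of_K_ne_0 hK0.ne', div_self hK0.ne']
    ring

/-- Remainders of small graph cost tend to `1` in the operator norm. The `V`-cost gives no such
control, which is why both seminorms are carried along. -/
theorem Reach.norm_sub_one_le {z : Bˣ} {ρ : ℝ} (h : D.Reach (normSeminorm ℝ (V × B)) z ρ) :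
    ‖(z : B) - 1‖ ≤ Real.exp ρ - 1 := by
  induction h with
  | seg hst h => exact h.norm_sub_one_le hst
  | @mul z z' ρ ρ' _ _ h h' =>
    have : ((z * z' : Bˣ) : B) - 1 = (z - 1 : B) * (z' - 1) + (z - 1) + (z' - 1) := by
      rw [Units.val_mul]; noncomm_ring
    rw [this, Real.exp_add]
    have h1 : ‖((z : B) - 1) * (z' - 1)‖ ≤ (Real.exp ρ - 1) * (Real.exp ρ' - 1) :=
      (norm_mul_le _ _).trans (mul_le_mul h h' (norm_nonneg _) ((norm_nonneg _).trans h))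
    have h2 := norm_add_le (((z : B) - 1) * (z' - 1) + (z - 1)) (z' - 1)
    have h3 := norm_add_le (((z : B) - 1) * (z' - 1)) (z - 1)
    linarith
  | mono _ hle h => exact h.trans (by gcongr)

end LieRealization

/-! ### Approximation by products of exponentials -/

namespace LieRealization

variable {V B : Type*} [NormedAddCommGroup V] [NormedSpace ℝ V] [CompleteSpace V]
  [NormedRing B] [NormedAlgebra ℝ B] [CompleteSpace B] (D : LieRealization V B)

/-- The product of the exponentials of the entries of a list. -/
noncomputable def prodExp (l : List V) : Bˣ := (l.map fun v => expUnit (D.ι v)).prod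

theorem prodExp_nil : D.prodExp [] = 1 := rfl

theorem prodExp_cons (v : V) (l : List V) :
    D.prodExp (v :: l) = expUnit (D.ι v) * D.prodExp l := by
  simp [prodExp]

theorem prodExp_append (l l' : List V) : D.prodExp (l ++ l') = D.prodExp l * D.prodExp l' := by
  simp [prodExp]

theorem prodExp_reverse_neg (l : List V) :
    D.prodExp (l.map Neg.neg).reverse = (D.prodExp l)⁻¹ := by
  induction l with
  | nil => simp [prodExp_nil]
  | cons v l ih =>
    rw [List.map_cons, List.reverse_cons, prodExp_append, ih, prodExp_cons, prodExp_cons,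
      prodExp_nil, map_neg, expUnit_neg, mul_one, mul_inv_rev]

variable {D} {N : Seminorm ℝ (V × B)}

theorem Reach.conj_prodExp {κ : ℝ} (hN : D.AdBounded N κ) (l : List V) {z : Bˣ} {ρ : ℝ}
    (h : D.Reach N z ρ) :
    D.Reach N (D.prodExp l * z * (D.prodExp l)⁻¹)
      (Real.exp (κ * (l.map fun v => N (D.pt v)).sum) * ρ) := by
  induction l with
  | nil => simpa [prodExp_nil] using h
  | cons v l ih =>
    have := ih.conj hN v
    rw [prodExp_cons, List.map_cons, List.sum_cons, mul_add, Real.exp_add, mul_assoc (Real.exp _)]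
    convert this using 1
    group

/-- For `e = exp ((τ - x) ι v)`, the curve `k = p e⁻¹` satisfies `k' = p (c - v) e⁻¹ = k Ad(e)(c -
v)`, so the error is driven by the transported difference of the two controls. -/
theorem IsSegment.reach_mul_expUnit_inv {κ : ℝ} (hN : D.AdBounded N κ) {N₁ : Seminorm ℝ (V × B)}
    {K s t : ℝ} {p : ℝ → Bˣ} {c : ℝ → V × B} (h : D.IsSegment N₁ K s t p c) {x y : ℝ}
    (hsx : s ≤ x) (hxy : x ≤ y) (hyt : y ≤ t) {v : V} {η : ℝ}
    (hη : ∀ τ ∈ Icc x y, N (c τ - D.pt v) ≤ η) :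
    D.Reach N ((p x)⁻¹ * p y * (expUnit (D.ι ((y - x) • v)))⁻¹)
      (Real.exp (κ * N (D.pt ((y - x) • v))) * η * (y - x)) := by
  have hsub : Icc x y ⊆ Icc s t := Icc_subset_Icc hsx hyt
  have hη0 : 0 ≤ η := (apply_nonneg N _).trans (hη x ⟨le_rfl, hxy⟩)
  set k : ℝ → Bˣ := fun τ => p τ * (expUnit (D.ι ((τ - x) • v)))⁻¹ with hk
  set c' : ℝ → V × B := fun τ => expL (D.adE ((τ - x) • v)) (c τ - D.pt v) with hc'
  have hexp : ∀ τ : ℝ, HasDerivAt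
      (fun τ : ℝ => (((expUnit (D.ι ((τ - x) • v)))⁻¹ : Bˣ) : B))
      (-(D.ι v * ((expUnit (D.ι ((τ - x) • v)))⁻¹ : Bˣ))) τ := by
    intro τ
    have h1 := (hasDerivAt_exp_smul_const' (-(D.ι v)) (τ - x)).scomp τ
      ((hasDerivAt_id τ).sub_const x)
    have h2 : ∀ τ : ℝ, (((expUnit (D.ι ((τ - x) • v)))⁻¹ : Bˣ) : B) =
        NormedSpace.exp ((τ - x) • (-(D.ι v))) := by
      intro τ
      rw [coe_expUnit_inv, map_smul, smul_neg]
    simp only [h2]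
    refine h1.congr_deriv ?_
    simp
  have hseg : D.IsSegment N (Real.exp (κ * N (D.pt ((y - x) • v))) * η) x y k c' :=
    { cont_path := by
        simp only [hk, Units.val_mul]
        exact (h.cont_path.mono hsub).mul fun τ _ => (hexp τ).continuousAt.continuousWithinAt
      cont_control := by
        refine ContinuousOn.clm_apply ?_ ((h.cont_control.mono hsub).sub continuousOn_const)
        simp only [adE_smul]
        exact ((continuous_expL_smul (D.adE v)).comp
          (continuous_id.sub continuous_const)).continuousOn
      mem := fun τ hτ =>
        (hN.exp_adE _ (sub_mem (h.mem τ (hsub hτ)) (D.pt_mem v))).1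
      bound := fun τ hτ => by
        refine (hN.exp_adE _ (sub_mem (h.mem τ (hsub hτ)) (D.pt_mem v))).2.trans ?_
        refine mul_le_mul ?_ (hη τ hτ) (apply_nonneg N _) (Real.exp_pos _).le
        simp only [map_smul, map_smul_eq_mul, Real.norm_of_nonneg (sub_nonneg.2 hτ.1),
          Real.norm_of_nonneg (sub_nonneg.2 hxy)]
        refine Real.exp_le_exp.2 (mul_le_mul_of_nonneg_left ?_ hN.nonneg)
        exact mul_le_mul_of_nonneg_right (by linarith [hτ.2]) (apply_nonneg N _)
      deriv := fun τ hτ => by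
        simp only [hk, hc', Units.val_mul]
        refine ((h.deriv τ ⟨hsx.trans_lt hτ.1, hτ.2.trans_le hyt⟩).mul (hexp τ)).congr_deriv ?_
        rw [snd_exp_adE, Prod.snd_sub, pt_snd]
        simp [mul_assoc, sub_eq_add_neg, mul_add, add_mul] }
  have := Reach.seg hxy hseg
  simp only [hk, sub_self, zero_smul, map_zero, expUnit_zero, inv_one, mul_one] at this
  rwa [← mul_assoc] at this

/-- The second error has to be moved past the first product; this conjugation is what costs the
exponential factor. -/
theorem reach_mul_prodExp_append {κ : ℝ} (hN : D.AdBounded N κ) {z z' : Bˣ} {l l' : List V}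
    {e e' : ℝ} (h : D.Reach N (z * (D.prodExp l)⁻¹) e) (h' : D.Reach N (z' * (D.prodExp l')⁻¹) e') :
    D.Reach N (z * z' * (D.prodExp (l ++ l'))⁻¹)
      (e + Real.exp (κ * (l.map fun v => N (D.pt v)).sum) * e') := by
  have := h.mul (h'.conj_prodExp hN l)
  rw [prodExp_append]
  convert this using 1
  group

/-- An element that can be reached can be approximated by products of exponentials of elements of a
set that is dense in the sense of `hsel`. -/
theorem Reach.exists_prodExp {κ : ℝ} (hN : D.AdBounded N κ) {N₁ : Seminorm ℝ (V × B)}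
    {P : V → Prop} {f : V → ℝ} (hP : ∀ r : ℝ, 0 ≤ r → ∀ v, P v → P (r • v))
    (hf : ∀ r : ℝ, 0 ≤ r → ∀ v, f (r • v) = r * f v)
    (hsel : ∀ c ∈ D.graphClosure, ∀ η > 0, ∃ v, P v ∧ N (c - D.pt v) ≤ η ∧ f v ≤ N₁ c + η)
    {z : Bˣ} {ρ : ℝ} (h : D.Reach N₁ z ρ) :
    ∃ σ, 0 ≤ σ ∧ ∀ ε > 0, ∃ l : List V, (∀ v ∈ l, P v) ∧ (l.map f).sum ≤ ρ + ε ∧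
      (l.map fun v => N (D.pt v)).sum ≤ σ ∧ D.Reach N (z * (D.prodExp l)⁻¹) ε := by
  have hκ := hN.nonneg
  have hsum0 : ∀ l : List V, 0 ≤ (l.map fun v => N (D.pt v)).sum := fun l =>
    List.sum_nonneg (by simp only [List.mem_map]; rintro _ ⟨v, -, rfl⟩; exact apply_nonneg N _)
  induction h with
  | @seg K₁ s t p c hst h =>
    obtain ⟨K, hK⟩ := isCompact_Icc.exists_bound_of_continuousOn
      (hN.continuous.comp_continuousOn h.cont_control)
    have hK' : ∀ τ ∈ Icc s t, N (c τ) ≤ K := fun τ hτ => (le_abs_self _).trans (hK τ hτ)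
    have hK0 : 0 ≤ K := (apply_nonneg N _).trans (hK' s ⟨le_rfl, hst⟩)
    have hts : 0 ≤ t - s := sub_nonneg.2 hst
    -- The bound on the total size of the exponents is fixed before `ε`, so that the product case
    -- can bound its conjugation factor before splitting `ε`.
    refine ⟨(K + 1) * (t - s), by positivity, fun ε hε => ?_⟩
    set σ := (K + 1) * (t - s) with hσ
    -- `η * W ≤ ε` serves two needs: the summand with `2 * exp` absorbs the remainder, the summand
    -- `1` the excess `η * (t - s)` in the sum of `f`.
    set W := (2 * Real.exp (κ * σ) + 1) * (t - s) with hW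
    have hW0 : 0 ≤ W := by positivity
    set η := min 1 (ε / (W + 1)) with hη
    have hη0 : 0 < η := lt_min one_pos (by positivity)
    have hη1 : η ≤ 1 := min_le_left _ _
    have hηW : η * W ≤ ε := by
      have : η ≤ ε / (W + 1) := min_le_right _ _
      rw [le_div_iff₀ (by positivity)] at this
      nlinarith
    have key : ∃ l : List V, (∀ v ∈ l, P v) ∧ (l.map f).sum ≤ (K₁ + η) * (t - s) ∧
        (l.map fun v => N (D.pt v)).sum ≤ (K + η) * (t - s) ∧
        D.Reach N ((p s)⁻¹ * p t * (D.prodExp l)⁻¹)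
          (Real.exp (κ * (l.map fun v => N (D.pt v)).sum) * (2 * η) * (t - s)) := by
      -- A single exponential works near each point, by continuity of the control. The claim is
      -- transitive because the remainder bound carries the factor `exp (κ * sum)`, which grows when
      -- lists are joined and so absorbs the conjugation.
      refine interval_induction (Q := fun x y => ∃ l : List V, (∀ v ∈ l, P v) ∧
        (l.map f).sum ≤ (K₁ + η) * (y - x) ∧
        (l.map fun v => N (D.pt v)).sum ≤ (K + η) * (y - x) ∧
        D.Reach N ((p x)⁻¹ * p y * (D.prodExp l)⁻¹)
          (Real.exp (κ * (l.map fun v => N (D.pt v)).sum) * (2 * η) * (y - x))) hst ?_ ?_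
      · intro x₀ hx₀
        obtain ⟨v, hPv, hNv, hfv⟩ := hsel (c x₀) (h.mem x₀ hx₀) η hη0
        have hcont : ContinuousWithinAt (fun τ => N (c τ - c x₀)) (Icc s t) x₀ :=
          hN.continuous.continuousAt.comp_continuousWithinAt
            ((h.cont_control x₀ hx₀).sub continuousWithinAt_const)
        obtain ⟨r, hr, hball⟩ := Metric.continuousWithinAt_iff.1 hcont η hη0
        have hnear : ∀ τ ∈ Icc s t, |τ - x₀| < r → N (c τ - D.pt v) ≤ 2 * η := by
          intro τ hτ hτr
          have h1 := hball hτ hτr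
          rw [Real.dist_eq, sub_self, map_zero, sub_zero, abs_of_nonneg (apply_nonneg N _)] at h1
          have h2 := map_add_le_add N (c τ - c x₀) (c x₀ - D.pt v)
          rw [sub_add_sub_cancel] at h2
          linarith
        have hNpt : N (D.pt v) ≤ K + η := by
          have h2 := map_add_le_add N (c x₀) (D.pt v - c x₀)
          rw [add_sub_cancel, map_sub_rev] at h2
          linarith [hK' x₀ hx₀]
        have hstep : ∀ x y, s ≤ x → x ≤ y → y ≤ t → (∀ τ ∈ Icc x y, |τ - x₀| < r) →
            ∃ l : List V, (∀ v ∈ l, P v) ∧ (l.map f).sum ≤ (K₁ + η) * (y - x) ∧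
            (l.map fun v => N (D.pt v)).sum ≤ (K + η) * (y - x) ∧
            D.Reach N ((p x)⁻¹ * p y * (D.prodExp l)⁻¹)
              (Real.exp (κ * (l.map fun v => N (D.pt v)).sum) * (2 * η) * (y - x)) := by
          intro x y hsx hxy hyt hxr
          have hyx : 0 ≤ y - x := sub_nonneg.2 hxy
          have hr' := h.reach_mul_expUnit_inv hN hsx hxy hyt (v := v) (η := 2 * η)
            fun τ hτ => hnear τ ⟨hsx.trans hτ.1, hτ.2.trans hyt⟩ (hxr τ hτ)
          refine ⟨[(y - x) • v], by simpa using hP _ hyx v hPv, ?_, ?_, ?_⟩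
          · simp only [List.map_cons, List.map_nil, List.sum_cons, List.sum_nil, add_zero,
              hf _ hyx]
            rw [mul_comm]
            exact mul_le_mul_of_nonneg_right (by linarith [h.bound x₀ hx₀]) hyx
          · simp only [List.map_cons, List.map_nil, List.sum_cons, List.sum_nil, add_zero,
              map_smul, map_smul_eq_mul, Real.norm_of_nonneg hyx]
            rw [mul_comm]
            exact mul_le_mul_of_nonneg_right hNpt hyx
          · simpa [prodExp_cons, prodExp_nil] using hr'
        refine ⟨r, hr, fun y hy hxy hyr => hstep x₀ y hx₀.1 hxy hy.2 fun τ hτ => ?_,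
          fun y hy hyr hyx => hstep y x₀ hy.1 hyx hx₀.2 fun τ hτ => ?_⟩
        · rw [abs_lt]; constructor <;> linarith [hτ.1, hτ.2]
        · rw [abs_lt]; constructor <;> linarith [hτ.1, hτ.2]
      · rintro x y w hsx hxy hyw hwt ⟨l, hl, hlf, hlN, hlr⟩ ⟨l', hl', hlf', hlN', hlr'⟩
        refine ⟨l ++ l', fun v hv => (List.mem_append.1 hv).elim (hl v) (hl' v), ?_, ?_, ?_⟩
        · rw [List.map_append, List.sum_append]; linarith
        · rw [List.map_append, List.sum_append]; linarith
        · have := reach_mul_prodExp_append hN hlr hlr'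
          have hz : (p x)⁻¹ * p y * ((p y)⁻¹ * p w) = (p x)⁻¹ * p w := by group
          rw [hz] at this
          refine this.mono ?_
          rw [List.map_append, List.sum_append, mul_add, Real.exp_add]
          set S := (l.map fun v => N (D.pt v)).sum
          set S' := (l'.map fun v => N (D.pt v)).sum
          have hS' : 1 ≤ Real.exp (κ * S') := Real.one_le_exp (mul_nonneg hκ (hsum0 l'))
          have hpos : 0 ≤ Real.exp (κ * S) * (2 * η) * (y - x) :=
            mul_nonneg (by positivity) (sub_nonneg.2 hxy)
          nlinarith
    obtain ⟨l, hl, hlf, hlN, hlr⟩ := key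
    have hlσ : (l.map fun v => N (D.pt v)).sum ≤ σ :=
      hlN.trans (mul_le_mul_of_nonneg_right (by linarith) hts)
    have hηts : η * (t - s) ≤ ε := by
      refine le_trans (mul_le_mul_of_nonneg_left ?_ hη0.le) hηW
      have : 0 ≤ 2 * Real.exp (κ * σ) * (t - s) := by positivity
      rw [hW]; linarith
    refine ⟨l, hl, by linarith, hlσ, hlr.mono ?_⟩
    have hexp : Real.exp (κ * (l.map fun v => N (D.pt v)).sum) ≤ Real.exp (κ * σ) :=
      Real.exp_le_exp.2 (mul_le_mul_of_nonneg_left hlσ hκ)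
    calc Real.exp (κ * (l.map fun v => N (D.pt v)).sum) * (2 * η) * (t - s)
        ≤ Real.exp (κ * σ) * (2 * η) * (t - s) := by gcongr
      _ ≤ η * W := by
        rw [hW]
        have : 0 ≤ η * (t - s) := by positivity
        linarith
      _ ≤ ε := hηW
  | @mul z z' ρ ρ' _ _ h h' =>
    obtain ⟨σ, hσ, h⟩ := h
    obtain ⟨σ', hσ', h'⟩ := h'
    refine ⟨σ + σ', add_nonneg hσ hσ', fun ε hε => ?_⟩
    set E := Real.exp (κ * σ) with hE
    have hE1 : 1 ≤ E := Real.one_le_exp (mul_nonneg hκ hσ)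
    -- One share for the first error, `E` shares for the conjugated second one.
    have hε' : 0 < ε / (1 + E) := by positivity
    have hmul : ε / (1 + E) * (1 + E) = ε := div_mul_cancel₀ _ (by positivity)
    obtain ⟨l, hl, hlf, hlN, hlr⟩ := h _ hε'
    obtain ⟨l', hl', hlf', hlN', hlr'⟩ := h' _ hε'
    refine ⟨l ++ l', fun v hv => (List.mem_append.1 hv).elim (hl v) (hl' v), ?_, ?_, ?_⟩
    · rw [List.map_append, List.sum_append]; nlinarith
    · rw [List.map_append, List.sum_append]; linarith
    · refine (reach_mul_prodExp_append hN hlr hlr').mono ?_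
      have : Real.exp (κ * (l.map fun v => N (D.pt v)).sum) ≤ E :=
        Real.exp_le_exp.2 (mul_le_mul_of_nonneg_left hlN hκ)
      nlinarith
  | mono _ hle h =>
    obtain ⟨σ, hσ, h⟩ := h
    refine ⟨σ, hσ, fun ε hε => ?_⟩
    obtain ⟨l, hl, hlf, hlN, hlr⟩ := h ε hε
    exact ⟨l, hl, by linarith, hlN, hlr⟩

/-- Left-sided version of `Reach.exists_prodExp`. -/
theorem Reach.exists_prodExp_left {κ : ℝ} (hN : D.AdBounded N κ) {N₁ : Seminorm ℝ (V × B)}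
    {f : V → ℝ} (hf : ∀ r : ℝ, 0 ≤ r → ∀ v, f (r • v) = r * f v) (hfn : ∀ v, f (-v) = f v)
    (hsel : ∀ c ∈ D.graphClosure, ∀ η > 0, ∃ v, N (c - D.pt v) ≤ η ∧ f v ≤ N₁ c + η)
    {z : Bˣ} {ρ : ℝ} (h : D.Reach N₁ z ρ) {ε : ℝ} (hε : 0 < ε) :
    ∃ l : List V, (l.map f).sum ≤ ρ + ε ∧ D.Reach N ((D.prodExp l)⁻¹ * z) ε := by
  -- Approximate `z⁻¹` on the right; inverting the product reverses the list and negates its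
  -- entries.
  obtain ⟨σ, -, hσ⟩ := h.inv.exists_prodExp hN (P := fun _ => True) (fun _ _ _ _ => trivial) hf
    fun c hc η hη => (hsel c hc η hη).imp fun v hv => ⟨trivial, hv⟩
  obtain ⟨l, -, hl, -, hlr⟩ := hσ ε hε
  refine ⟨(l.map Neg.neg).reverse, ?_, ?_⟩
  · rw [List.map_reverse, List.sum_reverse, List.map_map]
    convert hl using 3
    funext v
    exact hfn v
  · rw [prodExp_reverse_neg, inv_inv]
    simpa using hlr.inv

variable (D) in
/-- Although `ι` may be discontinuous, each element of `V` is a limit of elements whose images under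
`ι` are bounded in terms of its norm. -/
theorem exists_near_norm_ι_le :
    ∃ M : ℝ, 0 ≤ M ∧ ∀ x : V, ∀ η > 0, ∃ v, ‖x - v‖ ≤ η ∧ ‖D.ι v‖ ≤ M * ‖x‖ := by
  -- Baire: one of these closed sets has an interior point. Differences of two of its points fill a
  -- ball about `0` with bound `2 * n`, and scaling does the rest.
  set F : ℕ → Set V := fun n => closure {v | ‖D.ι v‖ ≤ n} with hF
  have hU : ⋃ n, F n = univ := by
    refine eq_univ_of_forall fun v => mem_iUnion.2 ?_
    obtain ⟨n, hn⟩ := exists_nat_ge ‖D.ι v‖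
    exact ⟨n, subset_closure hn⟩
  obtain ⟨n, x₀, hx₀⟩ := nonempty_interior_of_iUnion_of_closed (fun n => isClosed_closure) hU
  obtain ⟨r, hr, hball⟩ := Metric.mem_nhds_iff.1 (mem_interior_iff_mem_nhds.1 hx₀)
  have hsmall : ∀ x : V, ‖x‖ < r → ∀ η > 0, ∃ v, ‖x - v‖ ≤ η ∧ ‖D.ι v‖ ≤ 2 * n := by
    intro x hx η hη
    have h1 : x₀ + x ∈ F n := hball (by simpa using hx)
    have h0 : x₀ ∈ F n := hball (Metric.mem_ball_self hr)
    obtain ⟨v₁, hv₁, hd₁⟩ := Metric.mem_closure_iff.1 h1 (η / 2) (by positivity)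
    obtain ⟨v₀, hv₀, hd₀⟩ := Metric.mem_closure_iff.1 h0 (η / 2) (by positivity)
    rw [dist_eq_norm] at hd₁ hd₀
    refine ⟨v₁ - v₀, ?_, ?_⟩
    · have : x - (v₁ - v₀) = (x₀ + x - v₁) - (x₀ - v₀) := by abel
      rw [this]
      linarith [norm_sub_le (x₀ + x - v₁) (x₀ - v₀)]
    · rw [map_sub]
      have h1 : ‖D.ι v₁‖ ≤ n := hv₁
      have h2 : ‖D.ι v₀‖ ≤ n := hv₀
      linarith [norm_sub_le (D.ι v₁) (D.ι v₀)]
  refine ⟨2 * n * (2 / r), by positivity, fun x η hη => ?_⟩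
  rcases eq_or_ne x 0 with rfl | hx
  · exact ⟨0, by simpa using hη.le, by simp⟩
  have hxn : 0 < ‖x‖ := norm_pos_iff.2 hx
  -- Chosen so that `a⁻¹ • x` has norm `r / 2`.
  set a := 2 / r * ‖x‖ with ha
  have ha0 : 0 < a := by positivity
  have hax : ‖a⁻¹ • x‖ < r := by
    rw [norm_smul, norm_inv, Real.norm_of_nonneg ha0.le, ha, mul_inv, mul_assoc,
      inv_mul_cancel₀ hxn.ne', mul_one, inv_div]
    linarith
  obtain ⟨v, hv, hvn⟩ := hsmall _ hax (η / a) (by positivity)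
  refine ⟨a • v, ?_, ?_⟩
  · have : x - a • v = a • (a⁻¹ • x - v) := by rw [smul_sub, smul_inv_smul₀ ha0.ne']
    rw [this, norm_smul, Real.norm_of_nonneg ha0.le]
    rw [le_div_iff₀ ha0] at hv
    linarith
  · rw [map_smul, norm_smul, Real.norm_of_nonneg ha0.le, ha]
    have := mul_le_mul_of_nonneg_left hvn ha0.le
    rw [ha] at this
    linarith

end LieRealization

/-! ### Paths through infinite products -/

/-- A subdivision of `[0, 1)` whose steps are large compared to the terms of a given summable
sequence. -/
theorem exists_subdivision {r : ℕ → ℝ} (hr : ∀ j, 0 ≤ r j) (hs : Summable r) :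
    ∃ t : ℕ → ℝ, t 0 = 0 ∧ StrictMono t ∧ (∀ j, t j < 1) ∧ Tendsto t atTop (𝓝 1) ∧
      Tendsto (fun j => r j / (t (j + 1) - t j)) atTop (𝓝 0) := by
  -- The geometric term makes every term and every tail strictly positive, hence the subdivision
  -- strictly increasing.
  set s : ℕ → ℝ := fun j => r j + (1 / 2) ^ j with hsdef
  have hs0 : ∀ j, 0 < s j := fun j => add_pos_of_nonneg_of_pos (hr j) (by positivity)
  have hss : Summable s := hs.add summable_geometric_two
  set R : ℕ → ℝ := fun j => ∑' i, s (i + j) with hR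
  have hsj : ∀ j, Summable fun i => s (i + j) := fun j => (summable_nat_add_iff j).2 hss
  have hR0 : ∀ j, 0 < R j := fun j => (hsj j).tsum_pos (fun i => (hs0 _).le) 0 (hs0 _)
  have hRsucc : ∀ j, R j = s j + R (j + 1) := by
    intro j
    simp only [hR]
    rw [(hsj j).tsum_eq_zero_add, zero_add]
    congr 2
    funext i
    rw [add_right_comm, add_assoc]
  have hRlim : Tendsto R atTop (𝓝 0) := tendsto_sum_nat_add s
  -- Steps are differences of square roots of tails: `s j` factors as `(q j - q (j + 1)) * (q j + q
  -- (j + 1))`, so its ratio to the step is a multiple of `q j + q (j + 1)`, which tends to `0`.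
  set q : ℕ → ℝ := fun j => √(R j) with hq
  have hq0 : ∀ j, 0 < q j := fun j => Real.sqrt_pos.2 (hR0 j)
  have hqlim : Tendsto q atTop (𝓝 0) := by
    have := hRlim.sqrt
    rwa [Real.sqrt_zero] at this
  have hqq : ∀ j, (q j - q (j + 1)) * (q j + q (j + 1)) = s j := by
    intro j
    have h1 := Real.sq_sqrt (hR0 j).le
    have h2 := Real.sq_sqrt (hR0 (j + 1)).le
    have h3 := hRsucc j
    simp only [hq]
    linear_combination h1 - h2 + h3
  have hqlt : ∀ j, q (j + 1) < q j := fun j =>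
    Real.sqrt_lt_sqrt (hR0 _).le (by linarith [hRsucc j, hs0 j])
  have hdiff : ∀ j, (1 - q (j + 1) / q 0) - (1 - q j / q 0) = (q j - q (j + 1)) / q 0 := by
    intro j; ring
  refine ⟨fun j => 1 - q j / q 0, ?_, strictMono_nat_of_lt_succ fun j => ?_, fun j => ?_, ?_, ?_⟩
  · simp [div_self (hq0 0).ne']
  · have := div_pos (sub_pos.2 (hqlt j)) (hq0 0)
    linarith [hdiff j]
  · linarith [div_pos (hq0 j) (hq0 0)]
  · have := (hqlim.div_const (q 0)).const_sub 1
    simpa using this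
  · have hlim : Tendsto (fun j => q 0 * (q j + q (j + 1))) atTop (𝓝 0) := by
      have := (hqlim.add (hqlim.comp (tendsto_add_atTop_nat 1))).const_mul (q 0)
      simpa using this
    refine squeeze_zero (fun j => ?_) (fun j => ?_) hlim
    · rw [hdiff]
      exact div_nonneg (hr j) (div_pos (sub_pos.2 (hqlt j)) (hq0 0)).le
    · rw [hdiff, div_div_eq_mul_div, div_le_iff₀ (sub_pos.2 (hqlt j))]
      have h1 : r j ≤ s j := le_add_of_nonneg_right (by positivity)
      calc r j * q 0 ≤ s j * q 0 := mul_le_mul_of_nonneg_right h1 (hq0 0).le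
        _ = q 0 * (q j + q (j + 1)) * (q j - q (j + 1)) := by rw [← hqq j]; ring

/-- A continuously differentiable step from `0` to `1`. -/
theorem exists_smooth_step :
    ∃ (θ θ' : ℝ → ℝ) (K : ℝ), 0 ≤ K ∧ (∀ x, HasDerivAt θ (θ' x) x) ∧ Continuous θ' ∧
      (∀ x ≤ 0, θ x = 0 ∧ θ' x = 0) ∧ (∀ x, 1 ≤ x → θ x = 1 ∧ θ' x = 0) ∧
      (∀ x, |θ x| ≤ 1) ∧ ∀ x, |θ' x| ≤ K := by
  have hc : ContDiff ℝ 1 Real.smoothTransition := Real.smoothTransition.contDiff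
  have hd : Continuous (deriv Real.smoothTransition) := hc.continuous_deriv le_rfl
  have h0 : ∀ x ≤ 0, deriv Real.smoothTransition x = 0 := by
    intro x hx
    refine IsLocalMin.deriv_eq_zero (Eventually.of_forall fun y => ?_)
    rw [Real.smoothTransition.zero_of_nonpos hx]
    exact Real.smoothTransition.nonneg y
  have h1 : ∀ x, 1 ≤ x → deriv Real.smoothTransition x = 0 := by
    intro x hx
    refine IsLocalMax.deriv_eq_zero (Eventually.of_forall fun y => ?_)
    rw [Real.smoothTransition.one_of_one_le hx]
    exact Real.smoothTransition.le_one y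
  obtain ⟨K, hK⟩ := (isCompact_Icc (a := (0 : ℝ)) (b := 1)).exists_bound_of_continuousOn
    hd.continuousOn
  have hK0 : 0 ≤ K := (norm_nonneg _).trans (hK 0 ⟨le_rfl, zero_le_one⟩)
  refine ⟨Real.smoothTransition, deriv Real.smoothTransition, K, hK0,
    fun x => (hc.differentiable one_ne_zero x).hasDerivAt, hd,
    fun x hx => ⟨Real.smoothTransition.zero_of_nonpos hx, h0 x hx⟩,
    fun x hx => ⟨Real.smoothTransition.one_of_one_le hx, h1 x hx⟩, fun x => ?_, fun x => ?_⟩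
  · rw [abs_of_nonneg (Real.smoothTransition.nonneg x)]
    exact Real.smoothTransition.le_one x
  · rcases le_total x 0 with h | h
    · rw [h0 x h, abs_zero]; exact hK0
    rcases le_total 1 x with h' | h'
    · rw [h1 x h', abs_zero]; exact hK0
    · exact hK x ⟨h, h'⟩

section PartialPath

variable {B : Type*} [NormedRing B] [NormedAlgebra ℝ B] [CompleteSpace B]

theorem norm_expUnit_sub_one_le (X : B) : ‖(expUnit X : B) - 1‖ ≤ Real.exp ‖X‖ - 1 := by
  have h1 := (hasSum_nat_add_iff' 1).2 (NormedSpace.exp_series_hasSum_exp' (𝕂 := ℝ) X)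
  have h2 := (hasSum_nat_add_iff' 1).2 (NormedSpace.expSeries_div_hasSum_exp (𝔸 := ℝ) ‖X‖)
  simp only [Finset.range_one, Finset.sum_singleton, Nat.factorial_zero, Nat.cast_one, inv_one,
    pow_zero, one_smul, div_one] at h1 h2
  rw [← Real.exp_eq_exp_ℝ] at h2
  rw [coe_expUnit, ← h1.tsum_eq]
  refine tsum_of_norm_bounded h2 fun n => ?_
  rw [norm_smul, norm_inv, Real.norm_of_nonneg (Nat.cast_nonneg _), div_eq_inv_mul]
  gcongr
  exact norm_pow_le' X n.succ_pos

/-- The ordered product of the exponentials of `θ j τ • X j` for `j < n`. -/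
noncomputable def partialPath (X : ℕ → B) (θ : ℕ → ℝ → ℝ) : ℕ → ℝ → Bˣ
  | 0, _ => 1
  | n + 1, τ => partialPath X θ n τ * expUnit (θ n τ • X n)

/-- Each new factor differs from `1` by at most `exp ‖X j‖ - 1`, and the resulting bound telescopes.
It does not depend on `τ`, which yields continuity at the end point. -/
theorem norm_partialPath_sub_le {X : ℕ → B} {θ : ℕ → ℝ → ℝ} (hθ : ∀ j τ, |θ j τ| ≤ 1) (τ : ℝ)
    {n m : ℕ} (hnm : n ≤ m) :
    ‖(partialPath X θ m τ : B) - partialPath X θ n τ‖ ≤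
      ‖(1 : B)‖ * (Real.exp (∑ j ∈ Finset.range m, ‖X j‖) -
        Real.exp (∑ j ∈ Finset.range n, ‖X j‖)) := by
  have hexp : ∀ j, ‖(expUnit (θ j τ • X j) : B) - 1‖ ≤ Real.exp ‖X j‖ - 1 := by
    intro j
    refine (norm_expUnit_sub_one_le _).trans (sub_le_sub_right (Real.exp_le_exp.2 ?_) _)
    rw [norm_smul]
    exact mul_le_of_le_one_left (norm_nonneg _) (hθ j τ)
  have hstep : ∀ k, ‖(partialPath X θ (k + 1) τ : B) - partialPath X θ k τ‖ ≤
      ‖(partialPath X θ k τ : B)‖ * (Real.exp ‖X k‖ - 1) := by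
    intro k
    have : (partialPath X θ (k + 1) τ : B) - partialPath X θ k τ =
        partialPath X θ k τ * ((expUnit (θ k τ • X k) : B) - 1) := by
      rw [mul_sub, mul_one]; rfl
    rw [this]
    exact (norm_mul_le _ _).trans (mul_le_mul_of_nonneg_left (hexp k) (norm_nonneg _))
  have hbound : ∀ k, ‖(partialPath X θ k τ : B)‖ ≤
      ‖(1 : B)‖ * Real.exp (∑ j ∈ Finset.range k, ‖X j‖) := by
    intro k
    induction k with
    | zero => simp [partialPath]
    | succ k ih =>
      have h1 := hstep k
      have h2 := norm_le_norm_add_norm_sub' (partialPath X θ (k + 1) τ : B) (partialPath X θ k τ)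
      rw [Finset.sum_range_succ, Real.exp_add, ← mul_assoc]
      have h3 := mul_le_mul_of_nonneg_right ih (Real.exp_pos ‖X k‖).le
      linarith
  induction m, hnm using Nat.le_induction with
  | base => simp
  | succ m _ ih =>
    have h1 := hstep m
    have h2 := norm_sub_le_norm_sub_add_norm_sub (partialPath X θ (m + 1) τ : B)
      (partialPath X θ m τ) (partialPath X θ n τ)
    have h4 : (0 : ℝ) ≤ Real.exp ‖X m‖ - 1 := sub_nonneg.2 (Real.one_le_exp (norm_nonneg _))
    have h3 := mul_le_mul_of_nonneg_right (hbound m) h4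
    rw [Finset.sum_range_succ, Real.exp_add]
    nlinarith

/-- A sequence of continuously differentiable steps over the successive intervals
`[t j, t (j + 1)]`. -/
structure IsStepSequence (t : ℕ → ℝ) (θ θ' : ℕ → ℝ → ℝ) : Prop where
  mono : StrictMono t
  deriv : ∀ j τ, HasDerivAt (θ j) (θ' j τ) τ
  cont : ∀ j, Continuous (θ' j)
  before : ∀ j τ, τ ≤ t j → θ j τ = 0 ∧ θ' j τ = 0
  after : ∀ j τ, t (j + 1) ≤ τ → θ j τ = 1 ∧ θ' j τ = 0
  abs_le : ∀ j τ, |θ j τ| ≤ 1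

variable {t : ℕ → ℝ} {θ θ' : ℕ → ℝ → ℝ}

theorem IsStepSequence.sum_eq_of_le {E : Type*} [AddCommGroup E] [Module ℝ E]
    (h : IsStepSequence t θ θ') (x : ℕ → E) {n m : ℕ} (hnm : n ≤ m) {τ : ℝ} (hτ : τ ≤ t n) :
    ∑ j ∈ Finset.range m, θ' j τ • x j = ∑ j ∈ Finset.range n, θ' j τ • x j := by
  refine (Finset.sum_subset (Finset.range_mono hnm) fun j _ hj => ?_).symm
  rw [(h.before j τ (hτ.trans (h.mono.monotone (not_lt.1 (Finset.mem_range.not.1 hj))))).2,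
    zero_smul]

theorem IsStepSequence.partialPath_eq_of_le (h : IsStepSequence t θ θ') (X : ℕ → B) {n m : ℕ}
    (hnm : n ≤ m) {τ : ℝ} (hτ : τ ≤ t n) : partialPath X θ m τ = partialPath X θ n τ := by
  induction m, hnm using Nat.le_induction with
  | base => rfl
  | succ m hm ih =>
    rw [partialPath, ih, (h.before m τ (hτ.trans (h.mono.monotone hm))).1, zero_smul, expUnit_zero,
      mul_one]

/-- At most one factor moves at a time, and all factors to its right are still `1`; so no
conjugation enters the logarithmic derivative, although the `X j` need not commute. -/
theorem IsStepSequence.hasDerivAt_partialPath (h : IsStepSequence t θ θ') (X : ℕ → B) (n : ℕ)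
    (τ : ℝ) : HasDerivAt (fun τ => (partialPath X θ n τ : B))
      (partialPath X θ n τ * ∑ j ∈ Finset.range n, θ' j τ • X j) τ := by
  induction n with
  | zero => simpa [partialPath] using hasDerivAt_const τ (1 : B)
  | succ n ih =>
    have h2 : HasDerivAt (fun τ => (expUnit (θ n τ • X n) : B))
        (θ' n τ • (expUnit (θ n τ • X n) * X n)) τ :=
      (hasDerivAt_expUnit_smul (X n) (θ n τ)).scomp τ (h.deriv n τ)
    simp only [partialPath, Units.val_mul]
    refine (ih.mul h2).congr_deriv ?_
    rw [Finset.sum_range_succ]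
    rcases le_total τ (t n) with hτ | hτ
    · rw [(h.before n τ hτ).1, (h.before n τ hτ).2]
      simp [expUnit_zero]
    · have : ∑ j ∈ Finset.range n, θ' j τ • X j = 0 := Finset.sum_eq_zero fun j hj => by
        rw [(h.after j τ ((h.mono.monotone (Finset.mem_range.1 hj)).trans hτ)).2, zero_smul]
      rw [this]
      simp [mul_assoc]

theorem IsStepSequence.sum_eq_zero_or {E : Type*} [AddCommGroup E] [Module ℝ E]
    (h : IsStepSequence t θ θ') (x : ℕ → E) (n : ℕ) (τ : ℝ) :
    ∑ j ∈ Finset.range n, θ' j τ • x j = 0 ∨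
      ∃ j, τ ∈ Ioo (t j) (t (j + 1)) ∧ ∑ j ∈ Finset.range n, θ' j τ • x j = θ' j τ • x j := by
  by_cases hall : ∀ j ∈ Finset.range n, θ' j τ • x j = 0
  · exact Or.inl (Finset.sum_eq_zero hall)
  push Not at hall
  obtain ⟨j, hj, hne⟩ := hall
  have h1 : t j < τ := by
    by_contra hle
    exact hne (by rw [(h.before j τ (not_lt.1 hle)).2, zero_smul])
  have h2 : τ < t (j + 1) := by
    by_contra hle
    exact hne (by rw [(h.after j τ (not_lt.1 hle)).2, zero_smul])
  refine Or.inr ⟨j, ⟨h1, h2⟩, Finset.sum_eq_single j (fun i _ hij => ?_) fun hj' => absurd hj hj'⟩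
  rcases lt_or_gt_of_ne hij with hlt | hlt
  · rw [(h.after i τ ((h.mono.monotone hlt).trans h1.le)).2, zero_smul]
  · rw [(h.before i τ (h2.le.trans (h.mono.monotone hlt))).2, zero_smul]

end PartialPath

namespace LieRealization

variable {V B : Type*} [NormedAddCommGroup V] [NormedSpace ℝ V] [CompleteSpace V]
  [NormedRing B] [NormedAlgebra ℝ B] [CompleteSpace B] (D : LieRealization V B)

theorem prodExp_range_eq_partialPath (v : ℕ → V) {θ : ℕ → ℝ → ℝ} {τ : ℝ} (n : ℕ)
    (hθ : ∀ j < n, θ j τ = 1) :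
    D.prodExp ((List.range n).map v) = partialPath (fun j => D.ι (v j)) θ n τ := by
  induction n with
  | zero => rfl
  | succ n ih =>
    rw [List.range_succ, List.map_append, prodExp_append, ih fun j hj => hθ j (hj.trans n.lt_succ_self),
      partialPath, hθ n n.lt_succ_self]
    simp [prodExp_cons, prodExp_nil]

/-- There is a path in `C¹_CM` from `1` to `z` of length at most `ℓ`, with controls in `V`. -/
def HasPath (z : Bˣ) (ℓ : ℝ) : Prop :=
  ∃ (g : ℝ → Bˣ) (a : ℝ → V), ContinuousOn (fun τ => (g τ : B)) (Icc 0 1) ∧ g 0 = 1 ∧ g 1 = z ∧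
    (∀ τ ∈ Icc (0 : ℝ) 1, τ ∉ ({1} : Finset ℝ) →
      HasDerivWithinAt (fun τ => (g τ : B)) (g τ * D.ι (a τ)) (Icc 0 1) τ) ∧
    PiecewiseContinuous {1} (fun τ => D.pt (a τ)) ∧
    ∫⁻ τ in Icc (0 : ℝ) 1, ‖a τ‖ₑ ≤ ENNReal.ofReal ℓ

variable {D} in
theorem HasPath.mono {z : Bˣ} {ℓ ℓ' : ℝ} (h : D.HasPath z ℓ) (hle : ℓ ≤ ℓ') : D.HasPath z ℓ' := by
  obtain ⟨g, a, h1, h2, h3, h4, h5, h6⟩ := h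
  exact ⟨g, a, h1, h2, h3, h4, h5, h6.trans (ENNReal.ofReal_le_ofReal hle)⟩

/-- A convergent infinite product of exponentials is the end point of a path whose length is
bounded in terms of the norms of the exponents. -/
theorem exists_path_of_tendsto :
    ∃ K : ℝ, 0 ≤ K ∧ ∀ v : ℕ → V, (Summable fun j => ‖D.pt (v j)‖) → ∀ z : Bˣ,
      Tendsto (fun n => (D.prodExp ((List.range n).map v) : B)) atTop (𝓝 (z : B)) →
      D.HasPath z (K * ∑' j, ‖v j‖) := by
  obtain ⟨φ, φ', K, hK, hφd, hφc, hφ0, hφ1, hφb, hφK⟩ := exists_smooth_step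
  refine ⟨K, hK, fun v hv z hz => ?_⟩
  obtain ⟨t, ht0, htm, ht1, htlim, hratio⟩ := exists_subdivision (fun j => norm_nonneg (D.pt (v j))) hv
  have hΔ : ∀ j, 0 < t (j + 1) - t j := fun j => sub_pos.2 (htm j.lt_succ_self)
  set θ : ℕ → ℝ → ℝ := fun j τ => φ ((τ - t j) / (t (j + 1) - t j)) with hθ
  set θ' : ℕ → ℝ → ℝ := fun j τ => φ' ((τ - t j) / (t (j + 1) - t j)) / (t (j + 1) - t j) with hθ'
  have hstep : IsStepSequence t θ θ' :=
    { mono := htm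
      deriv := fun j τ => by
        have h1 : HasDerivAt (fun τ : ℝ => (τ - t j) / (t (j + 1) - t j))
            (1 / (t (j + 1) - t j)) τ := ((hasDerivAt_id τ).sub_const _).div_const _
        refine ((hφd _).comp τ h1).congr_deriv ?_
        simp only [hθ']
        ring
      cont := fun j => (hφc.comp ((continuous_id.sub continuous_const).div_const _)).div_const _
      before := fun j τ hτ => by
        have := hφ0 ((τ - t j) / (t (j + 1) - t j))
          (div_nonpos_of_nonpos_of_nonneg (by linarith) (hΔ j).le)
        exact ⟨this.1, by simp only [hθ']; rw [this.2, zero_div]⟩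
      after := fun j τ hτ => by
        have := hφ1 ((τ - t j) / (t (j + 1) - t j)) ((one_le_div (hΔ j)).2 (by linarith))
        exact ⟨this.1, by simp only [hθ']; rw [this.2, zero_div]⟩
      abs_le := fun j τ => hφb _ }
  have hθ'b : ∀ j τ, |θ' j τ| ≤ K / (t (j + 1) - t j) := fun j τ => by
    simp only [hθ']
    rw [abs_div, abs_of_pos (hΔ j)]
    exact div_le_div_of_nonneg_right (hφK _) (hΔ j).le
  set X : ℕ → B := fun j => D.ι (v j) with hX
  set P := partialPath X θ with hP
  have hex : ∀ τ : ℝ, τ < 1 → ∃ n, τ < t n := fun τ hτ =>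
    ((htlim.eventually (lt_mem_nhds hτ)).exists)
  classical
  -- Before time `1` only finitely many factors have started, so every late enough partial path
  -- gives the same value; from time `1` on the value is the limit `z`.
  set g : ℝ → Bˣ := fun τ => if h : ∃ n, τ ≤ t n then P (Nat.find h) τ else z with hg
  set a : ℝ → V := fun τ => if h : ∃ n, τ ≤ t n then
    ∑ j ∈ Finset.range (Nat.find h), θ' j τ • v j else 0 with ha
  have hgP : ∀ n τ, τ ≤ t n → g τ = P n τ := by
    intro n τ hτ
    have h : ∃ n, τ ≤ t n := ⟨n, hτ⟩
    simp only [hg, dif_pos h]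
    exact (hstep.partialPath_eq_of_le X (Nat.find_min' h hτ) (Nat.find_spec h)).symm
  have haS : ∀ n τ, τ ≤ t n → a τ = ∑ j ∈ Finset.range n, θ' j τ • v j := by
    intro n τ hτ
    have h : ∃ n, τ ≤ t n := ⟨n, hτ⟩
    simp only [ha, dif_pos h]
    exact (hstep.sum_eq_of_le v (Nat.find_min' h hτ) (Nat.find_spec h)).symm
  have hnot : ∀ τ : ℝ, 1 ≤ τ → ¬ ∃ n, τ ≤ t n := fun τ hτ ⟨n, hn⟩ =>
    absurd (hτ.trans hn) (not_le.2 (ht1 n))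
  have hg1 : g 1 = z := by simp only [hg, dif_neg (hnot 1 le_rfl)]
  have ha1 : ∀ τ : ℝ, 1 ≤ τ → a τ = 0 := fun τ hτ => by simp only [ha, dif_neg (hnot τ hτ)]
  have hgder : ∀ τ < 1, HasDerivAt (fun τ => (g τ : B)) (g τ * D.ι (a τ)) τ := by
    intro τ hτ
    obtain ⟨n, hn⟩ := hex τ hτ
    have h1 := hstep.hasDerivAt_partialPath X n τ
    have h2 : D.ι (a τ) = ∑ j ∈ Finset.range n, θ' j τ • X j := by
      rw [haS n τ hn.le, map_sum]
      simp only [map_smul, hX]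
    rw [h2, hgP n τ hn.le]
    refine h1.congr_of_eventuallyEq ?_
    filter_upwards [Iio_mem_nhds hn] with x hx
    rw [hgP n x (le_of_lt hx)]
  have hacont : ∀ τ < 1, ContinuousAt (fun τ => D.pt (a τ)) τ := by
    intro τ hτ
    obtain ⟨n, hn⟩ := hex τ hτ
    have h1 : Continuous fun τ => ∑ j ∈ Finset.range n, θ' j τ • D.pt (v j) :=
      continuous_finsetSum _ fun j _ => (hstep.cont j).smul continuous_const
    refine h1.continuousAt.congr ?_
    filter_upwards [Iio_mem_nhds hn] with x hx
    rw [haS n x (le_of_lt hx), map_sum]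
    simp only [map_smul]
  have hacase : ∀ τ, a τ = 0 ∨ ∃ j, τ ∈ Ioo (t j) (t (j + 1)) ∧ a τ = θ' j τ • v j := by
    intro τ
    rcases lt_or_ge τ 1 with hτ | hτ
    · obtain ⟨n, hn⟩ := hex τ hτ
      rw [haS n τ hn.le]
      exact hstep.sum_eq_zero_or v n τ
    · exact Or.inl (ha1 τ hτ)
  -- This is what the subdivision was chosen for: the speed on the `j`-th interval is at most `K *
  -- ‖pt (v j)‖ / (t (j + 1) - t j)`, which tends to `0`. Thus `1` is the only break point although
  -- infinitely many pieces accumulate there.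
  have halim : Tendsto (fun τ => D.pt (a τ)) (𝓝[<] 1) (𝓝 0) := by
    rw [Metric.tendsto_nhds]
    intro ε hε
    have hev : ∀ᶠ j in atTop, K * (‖D.pt (v j)‖ / (t (j + 1) - t j)) < ε := by
      have := hratio.const_mul K
      rw [mul_zero] at this
      exact this.eventually (gt_mem_nhds hε)
    obtain ⟨n, hn⟩ := eventually_atTop.1 hev
    filter_upwards [Ioo_mem_nhdsLT (ht1 n)] with τ hτ
    rw [dist_zero_right]
    rcases hacase τ with h0 | ⟨j, hj, hja⟩
    · rw [h0, map_zero, norm_zero]; exact hε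
    · have hnj : n ≤ j := by
        have := htm.lt_iff_lt.1 (hτ.1.trans hj.2)
        omega
      refine lt_of_le_of_lt ?_ (hn j hnj)
      rw [hja, map_smul, norm_smul, Real.norm_eq_abs, mul_div_left_comm, mul_comm ‖_‖]
      have := hθ'b j τ
      exact mul_le_mul_of_nonneg_right this (norm_nonneg _)
  have hXsum : Summable fun j => ‖X j‖ :=
    Summable.of_nonneg_of_le (fun _ => norm_nonneg _) (fun j => norm_snd_le (D.pt (v j))) hv
  have hgcont1 : ContinuousWithinAt (fun τ => (g τ : B)) (Icc 0 1) 1 := by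
    set S : ℕ → ℝ := fun n => ∑ j ∈ Finset.range n, ‖X j‖ with hS
    have hSlim : Tendsto S atTop (𝓝 (∑' j, ‖X j‖)) := hXsum.hasSum.tendsto_sum_nat
    have hSle : ∀ n, S n ≤ ∑' j, ‖X j‖ := fun n =>
      hXsum.sum_le_tsum _ fun _ _ => norm_nonneg _
    set ψ : ℕ → ℝ := fun n => ‖(1 : B)‖ * (Real.exp (∑' j, ‖X j‖) - Real.exp (S n)) +
      ‖(D.prodExp ((List.range n).map v) : B) - z‖ with hψ
    have hψlim : Tendsto ψ atTop (𝓝 0) := by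
      have h1 : Tendsto (fun n => Real.exp (S n)) atTop (𝓝 (Real.exp (∑' j, ‖X j‖))) :=
        (Real.continuous_exp.tendsto _).comp hSlim
      have h2 := (h1.const_sub (Real.exp (∑' j, ‖X j‖))).const_mul ‖(1 : B)‖
      have h3 := (tendsto_iff_norm_sub_tendsto_zero.1 hz)
      have := h2.add h3
      simpa using this
    rw [ContinuousWithinAt, hg1, Metric.tendsto_nhds]
    intro ε hε
    obtain ⟨n, hn⟩ := (hψlim.eventually (gt_mem_nhds hε)).exists
    filter_upwards [mem_nhdsWithin_of_mem_nhds (lt_mem_nhds (ht1 n)), self_mem_nhdsWithin]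
      with τ hτ hτI
    rw [dist_eq_norm]
    rcases hτI.2.lt_or_eq with hlt | rfl
    · obtain ⟨m, hm⟩ := hex τ hlt
      have hnm : n ≤ m := (htm.lt_iff_lt.1 (lt_trans hτ hm)).le
      have h1 := norm_partialPath_sub_le (X := X) hstep.abs_le τ hnm
      have h2 : D.prodExp ((List.range n).map v) = P n τ :=
        D.prodExp_range_eq_partialPath v n fun j hj =>
          (hstep.after j τ ((htm.monotone hj).trans (le_of_lt hτ))).1
      rw [hgP m τ hm.le]
      refine lt_of_le_of_lt ?_ hn
      have h3 := norm_sub_le_norm_sub_add_norm_sub (P m τ : B) (P n τ) (z : B)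
      have h4 : ‖(1 : B)‖ * (Real.exp (S m) - Real.exp (S n)) ≤
          ‖(1 : B)‖ * (Real.exp (∑' j, ‖X j‖) - Real.exp (S n)) := by
        gcongr
        exact hSle m
      simp only [hψ]
      rw [h2]
      exact h3.trans (add_le_add_left (h1.trans h4) _)
    · rw [hg1, sub_self, norm_zero]; exact hε
  refine ⟨g, a, ?_, ?_, hg1, ?_, ⟨?_, ?_, ?_⟩, ?_⟩
  · intro τ hτ
    rcases hτ.2.lt_or_eq with hlt | rfl
    · exact (hgder τ hlt).continuousAt.continuousWithinAt
    · exact hgcont1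
  · rw [hgP 0 0 ht0.ge]; rfl
  · intro τ hτ hτ1
    exact (hgder τ (lt_of_le_of_ne hτ.2 (by simpa using hτ1))).hasDerivWithinAt
  · intro τ hτ hτ1
    exact (hacont τ (lt_of_le_of_ne hτ.2 (by simpa using hτ1))).continuousWithinAt
  · intro τ hτ
    rcases hτ.2.lt_or_eq with hlt | rfl
    · exact ⟨_, (hacont τ hlt).tendsto.mono_left nhdsWithin_le_nhds⟩
    · exact ⟨0, halim⟩
  · intro τ hτ
    exact ⟨_, (hacont τ hτ.2).tendsto.mono_left nhdsWithin_le_nhds⟩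
  · have hvsum : Summable fun j => ‖v j‖ :=
      Summable.of_nonneg_of_le (fun _ => norm_nonneg _) (fun j => norm_fst_le (D.pt (v j))) hv
    -- The length of each interval cancels against the speed, so the `j`-th piece contributes at
    -- most `K * ‖v j‖`.
    set w : ℕ → ℝ → ℝ≥0∞ := fun j => (Ioo (t j) (t (j + 1))).indicator
      fun _ => ENNReal.ofReal (K / (t (j + 1) - t j) * ‖v j‖) with hw
    have hpt : ∀ τ, ‖a τ‖ₑ ≤ ∑' j, w j τ := by
      intro τ
      rcases hacase τ with h0 | ⟨j, hj, hja⟩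
      · simp [h0]
      · refine le_trans ?_ (ENNReal.le_tsum j)
        simp only [hw, indicator_of_mem hj]
        rw [hja, ← ofReal_norm, norm_smul]
        exact ENNReal.ofReal_le_ofReal (mul_le_mul_of_nonneg_right (hθ'b j τ) (norm_nonneg _))
    calc ∫⁻ τ in Icc (0 : ℝ) 1, ‖a τ‖ₑ ≤ ∫⁻ τ, ‖a τ‖ₑ := setLIntegral_le_lintegral _ _
      _ ≤ ∫⁻ τ, ∑' j, w j τ := lintegral_mono hpt
      _ = ∑' j, ∫⁻ τ, w j τ := lintegral_tsum fun j =>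
          (measurable_const.indicator measurableSet_Ioo).aemeasurable
      _ = ∑' j, ENNReal.ofReal (K * ‖v j‖) := by
          congr 1
          funext j
          simp only [hw]
          rw [lintegral_indicator measurableSet_Ioo, setLIntegral_const, Real.volume_Ioo,
            ← ENNReal.ofReal_mul (by have := hΔ j; positivity)]
          congr 1
          have := (hΔ j).ne'
          field_simp
      _ = ENNReal.ofReal (∑' j, K * ‖v j‖) :=
          (ENNReal.ofReal_tsum_of_nonneg (fun j => by positivity) (hvsum.mul_left K)).symm
      _ = ENNReal.ofReal (K * ∑' j, ‖v j‖) := by rw [tsum_mul_left]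

end LieRealization

/-! ### Infinite products in blocks -/

/-- An infinite concatenation of nonempty lists is a sequence. -/
theorem exists_seq_of_lists {α : Type*} [Inhabited α] (L : ℕ → List α) (hL : ∀ k, L k ≠ []) :
    ∃ (v : ℕ → α) (n : ℕ → ℕ), StrictMono n ∧
      ∀ k, (List.range (n k)).map v = (List.range k).flatMap L := by
  set M : ℕ → List α := fun k => (List.range k).flatMap L with hM
  have hsucc : ∀ k, M (k + 1) = M k ++ L k := fun k => by
    simp [hM, List.range_succ, List.flatMap_append]
  have hpre : ∀ {k m}, k ≤ m → M k <+: M m := by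
    intro k m hkm
    induction m, hkm using Nat.le_induction with
    | base => exact List.prefix_rfl
    | succ m _ ih => exact ih.trans (hsucc m ▸ List.prefix_append _ _)
  have hlen : StrictMono fun k => (M k).length := strictMono_nat_of_lt_succ fun k => by
    have := List.length_pos_iff.2 (hL k)
    rw [hsucc, List.length_append]
    omega
  -- The lists are nonempty, so the `(i + 1)`-st prefix has more than `i` entries and the default is
  -- never used.
  refine ⟨fun i => (M (i + 1)).getD i default, fun k => (M k).length, hlen, fun k => ?_⟩
  refine List.ext_getElem (by rw [List.length_map, List.length_range]) fun i h1 h2 => ?_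
  have hi : i < (M (i + 1)).length := (Nat.lt_succ_self i).trans_le (hlen.id_le (i + 1))
  simp only [List.getElem_map, List.getElem_range]
  rw [List.getD_eq_getElem _ _ hi]
  rcases le_total (i + 1) k with h | h
  · exact (hpre h).getElem hi
  · exact ((hpre h).getElem h2).symm

namespace LieRealization

variable {V B : Type*} [NormedAddCommGroup V] [NormedSpace ℝ V] [CompleteSpace V]
  [NormedRing B] [NormedAlgebra ℝ B] [CompleteSpace B] (D : LieRealization V B)

/-- The partial products of an infinite product of blocks of exponentials. -/
noncomputable def blockProd (L : ℕ → List V) (k : ℕ) : Bˣ := D.prodExp ((List.range k).flatMap L)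

theorem blockProd_zero (L : ℕ → List V) : D.blockProd L 0 = 1 := rfl

theorem blockProd_succ (L : ℕ → List V) (k : ℕ) :
    D.blockProd L (k + 1) = D.blockProd L k * D.prodExp (L k) := by
  simp [blockProd, List.range_succ, List.flatMap_append, prodExp_append]

theorem blockProd_add (L : ℕ → List V) (k j : ℕ) :
    D.blockProd L (k + j) = D.blockProd L k * D.blockProd (fun i => L (k + i)) j := by
  induction j with
  | zero => simp [blockProd_zero]
  | succ j ih => rw [← add_assoc, blockProd_succ, ih, blockProd_succ, mul_assoc]

theorem blockProd_cons_zero (L : ℕ → List V) (k : ℕ) :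
    D.blockProd (fun i => 0 :: L i) k = D.blockProd L k := by
  induction k with
  | zero => rfl
  | succ k ih => rw [blockProd_succ, blockProd_succ, ih, prodExp_cons, map_zero, expUnit_zero,
      one_mul]

theorem sum_map_flatMap_range {α : Type*} (L : ℕ → List α) (f : α → ℝ) (k : ℕ) :
    (((List.range k).flatMap L).map f).sum = ∑ i ∈ Finset.range k, ((L i).map f).sum := by
  induction k with
  | zero => rfl
  | succ k ih =>
    rw [Finset.sum_range_succ, ← ih, List.range_succ, List.flatMap_append, List.map_append,
      List.sum_append]
    simp

/-- A rearrangement of a block product into a product of single exponentials. -/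
theorem exists_seq_of_blocks {L : ℕ → List V}
    (hL : Summable fun k => ((L k).map fun v => ‖D.pt v‖).sum) :
    ∃ (v : ℕ → V) (n : ℕ → ℕ), StrictMono n ∧ (Summable fun j => ‖D.pt (v j)‖) ∧
      (∀ k, D.prodExp ((List.range (n k)).map v) = D.blockProd L k) ∧
      ∑' j, ‖v j‖ ≤ ∑' k, ((L k).map fun v => ‖v‖).sum := by
  have : Inhabited V := ⟨0⟩
  -- A leading `0` makes each block nonempty and changes neither the product nor the sums.
  obtain ⟨v, n, hn, hv⟩ := exists_seq_of_lists (fun k => 0 :: L k) fun k => by simp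
  have hsum : ∀ f : V → ℝ, f 0 = 0 → ∀ k,
      ∑ i ∈ Finset.range (n k), f (v i) = ∑ i ∈ Finset.range k, ((L i).map f).sum := by
    intro f hf k
    have h1 := sum_map_flatMap_range (fun k => 0 :: L k) f k
    rw [← hv k, List.map_map] at h1
    rw [Finset.sum_range, ← List.sum_ofFn]
    simp only [List.map_cons, List.sum_cons, hf, zero_add] at h1
    rw [← h1]
    congr 1
    rw [List.ofFn_eq_map, ← List.map_coe_finRange_eq_range, List.map_map]
    rfl
  have hnn : ∀ (f : V → ℝ) (_ : ∀ x, 0 ≤ f x) (l : List V), 0 ≤ (l.map f).sum := fun f hf l =>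
    List.sum_nonneg (by simp only [List.mem_map]; rintro _ ⟨x, -, rfl⟩; exact hf x)
  have hpart : ∀ f : V → ℝ, f 0 = 0 → (∀ x, 0 ≤ f x) →
      (Summable fun k => ((L k).map f).sum) → ∀ m,
      ∑ i ∈ Finset.range m, f (v i) ≤ ∑' k, ((L k).map f).sum := by
    intro f hf hf0 hs m
    calc ∑ i ∈ Finset.range m, f (v i) ≤ ∑ i ∈ Finset.range (n m), f (v i) :=
          Finset.sum_le_sum_of_subset_of_nonneg (Finset.range_mono (hn.id_le m)) fun i _ _ => hf0 _
      _ = ∑ i ∈ Finset.range m, ((L i).map f).sum := hsum f hf m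
      _ ≤ _ := hs.sum_le_tsum _ fun i _ => hnn f hf0 _
  have hL' : Summable fun k => ((L k).map fun v => ‖v‖).sum :=
    Summable.of_nonneg_of_le (fun k => hnn _ (fun x => norm_nonneg x) _)
      (fun k => List.sum_le_sum fun x _ => norm_fst_le (D.pt x)) hL
  have hs1 : Summable fun j => ‖D.pt (v j)‖ := summable_of_sum_range_le (fun _ => norm_nonneg _)
    (hpart (fun x => ‖D.pt x‖) (by simp) (fun _ => norm_nonneg _) hL)
  refine ⟨v, n, hn, hs1, fun k => ?_, ?_⟩
  · rw [hv k, ← D.blockProd_cons_zero]; rfl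
  · exact Real.tsum_le_of_sum_range_le (fun _ => norm_nonneg _)
      (hpart (fun x => ‖x‖) norm_zero norm_nonneg hL')

theorem prodExp_range_add (v : ℕ → V) (n m : ℕ) :
    D.prodExp ((List.range (n + m)).map v) =
      D.prodExp ((List.range n).map v) * D.prodExp ((List.range m).map fun j => v (n + j)) := by
  rw [List.range_add, List.map_append, prodExp_append, List.map_map]
  rfl

/-- An absolutely convergent infinite product of exponentials converges to an invertible element. -/
theorem exists_tendsto_prodExp {v : ℕ → V} (hv : Summable fun j => ‖D.pt (v j)‖) :
    ∃ z : Bˣ, Tendsto (fun n => (D.prodExp ((List.range n).map v) : B)) atTop (𝓝 (z : B)) := by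
  have hest : ∀ (v : ℕ → V) (n m : ℕ), n ≤ m →
      ‖(D.prodExp ((List.range m).map v) : B) - D.prodExp ((List.range n).map v)‖ ≤
      ‖(1 : B)‖ * (Real.exp (∑ j ∈ Finset.range m, ‖D.ι (v j)‖) -
        Real.exp (∑ j ∈ Finset.range n, ‖D.ι (v j)‖)) := by
    intro v n m hnm
    rw [D.prodExp_range_eq_partialPath v (θ := fun _ _ => 1) (τ := 0) m fun _ _ => rfl,
      D.prodExp_range_eq_partialPath v (θ := fun _ _ => 1) (τ := 0) n fun _ _ => rfl]
    exact norm_partialPath_sub_le (fun _ _ => by simp) 0 hnm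
  have hX : Summable fun j => ‖D.ι (v j)‖ :=
    Summable.of_nonneg_of_le (fun _ => norm_nonneg _) (fun j => norm_snd_le (D.pt (v j))) hv
  set S : ℕ → ℝ := fun n => ∑ j ∈ Finset.range n, ‖D.ι (v j)‖ with hS
  set T : ℝ := ∑' j, ‖D.ι (v j)‖ with hT
  have hSlim : Tendsto S atTop (𝓝 T) := hX.hasSum.tendsto_sum_nat
  have hST : ∀ n, S n ≤ T := fun n => hX.sum_le_tsum _ fun _ _ => norm_nonneg _
  have hcauchy : CauchySeq fun n => (D.prodExp ((List.range n).map v) : B) := by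
    refine cauchySeq_of_le_tendsto_0' (fun n => ‖(1 : B)‖ * (Real.exp T - Real.exp (S n)))
      (fun n m hnm => ?_) ?_
    · rw [dist_comm, dist_eq_norm]
      refine (hest v n m hnm).trans ?_
      gcongr
      exact hST m
    · have h1 : Tendsto (fun n => Real.exp (S n)) atTop (𝓝 (Real.exp T)) :=
        (Real.continuous_exp.tendsto _).comp hSlim
      simpa using (h1.const_sub (Real.exp T)).const_mul ‖(1 : B)‖
  obtain ⟨y, hy⟩ := cauchySeq_tendsto_of_complete hcauchy
  have hsmall : Tendsto (fun n => ‖(1 : B)‖ * (Real.exp (T - S n) - 1)) atTop (𝓝 0) := by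
    have h1 : Tendsto (fun n => Real.exp (T - S n)) atTop (𝓝 (Real.exp (T - T))) :=
      (Real.continuous_exp.tendsto _).comp (hSlim.const_sub T)
    simpa using (h1.sub_const 1).const_mul ‖(1 : B)‖
  -- A limit of invertible elements need not be invertible. Splitting off a long enough initial
  -- product `Q` leaves a tail within distance less than `1` of `1`, hence invertible.
  obtain ⟨n, hn⟩ := (hsmall.eventually (gt_mem_nhds one_pos)).exists
  set Q := D.prodExp ((List.range n).map v) with hQ
  have htail : Tendsto (fun m => (D.prodExp ((List.range m).map fun j => v (n + j)) : B)) atTop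
      (𝓝 (((Q⁻¹ : Bˣ) : B) * y)) := by
    have h1 := (tendsto_add_atTop_iff_nat n).2 hy
    refine (h1.const_mul ((Q⁻¹ : Bˣ) : B)).congr fun m => ?_
    rw [add_comm m n, prodExp_range_add, ← hQ, Units.val_mul, Units.inv_mul_cancel_left]
  have hclose : ‖(((Q⁻¹ : Bˣ) : B) * y) - 1‖ < 1 := by
    refine lt_of_le_of_lt (le_of_tendsto (htail.sub_const 1).norm
      (Eventually.of_forall fun m => ?_)) hn
    have h1 := hest (fun j => v (n + j)) 0 m (Nat.zero_le m)
    simp only [List.range_zero, List.map_nil, prodExp_nil, Units.val_one, Finset.range_zero,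
      Finset.sum_empty, Real.exp_zero] at h1
    refine h1.trans ?_
    gcongr
    have h2 : S (n + m) = S n + ∑ j ∈ Finset.range m, ‖D.ι (v (n + j))‖ :=
      Finset.sum_range_add _ _ _
    linarith [hST (n + m)]
  have hu : IsUnit (((Q⁻¹ : Bˣ) : B) * y) := by
    have := isUnit_one_sub_of_norm_lt_one (x := 1 - ((Q⁻¹ : Bˣ) : B) * y)
      (by rwa [norm_sub_rev])
    rwa [sub_sub_cancel] at this
  rw [Units.isUnit_units_mul] at hu
  obtain ⟨z, rfl⟩ := hu
  exact ⟨z, hy⟩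

theorem exists_tendsto_blockProd {L : ℕ → List V}
    (hL : Summable fun k => ((L k).map fun v => ‖D.pt v‖).sum) :
    ∃ z : Bˣ, Tendsto (fun k => (D.blockProd L k : B)) atTop (𝓝 (z : B)) := by
  obtain ⟨v, n, hn, hv, hnv, -⟩ := D.exists_seq_of_blocks hL
  obtain ⟨z, hz⟩ := D.exists_tendsto_prodExp hv
  refine ⟨z, (hz.comp hn.tendsto_atTop).congr fun k => ?_⟩
  rw [Function.comp_apply, hnv]

/-- Convergence is known only at the ends of blocks. The product of single exponentials converges on
its own by absolute summability, and its limit is then forced to be `z`. -/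
theorem exists_hasPath_of_tendsto_blockProd :
    ∃ K : ℝ, 0 ≤ K ∧ ∀ L : ℕ → List V,
      (Summable fun k => ((L k).map fun v => ‖D.pt v‖).sum) → ∀ z : Bˣ,
      Tendsto (fun k => (D.blockProd L k : B)) atTop (𝓝 (z : B)) →
      D.HasPath z (K * ∑' k, ((L k).map fun v => ‖v‖).sum) := by
  obtain ⟨K, hK, hpath⟩ := D.exists_path_of_tendsto
  refine ⟨K, hK, fun L hL z hz => ?_⟩
  obtain ⟨v, n, hn, hv, hnv, hle⟩ := D.exists_seq_of_blocks hL
  obtain ⟨y, hy⟩ := D.exists_tendsto_prodExp hv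
  have hyz : (y : B) = z := tendsto_nhds_unique (hy.comp hn.tendsto_atTop)
    (hz.congr fun k => by rw [Function.comp_apply, hnv])
  exact (hpath v hv z (hyz ▸ hy)).mono (mul_le_mul_of_nonneg_left hle hK)

variable {D}

theorem sum_map_norm_le (l : List V) :
    (l.map fun v => ‖v‖).sum ≤ (l.map fun v => ‖D.pt v‖).sum :=
  List.sum_le_sum fun v _ => norm_fst_le (D.pt v)

theorem sum_map_norm_pt_nonneg (l : List V) : 0 ≤ (l.map fun v => ‖D.pt v‖).sum :=
  List.sum_nonneg (by simp only [List.mem_map]; rintro _ ⟨x, -, rfl⟩; exact norm_nonneg _)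

/-- An element reached by controls in the closure of the graph of `ι` is reached by a path in
`C¹_CM`, whose length is bounded by the size of the `V`-components of the controls. -/
theorem Reach.exists_hasPath (D : LieRealization V B) :
    ∃ K : ℝ, 0 ≤ K ∧ ∀ (z : Bˣ) (ρ : ℝ), D.Reach (fstSeminorm V B) z ρ → ∀ ε > 0,
      D.HasPath z (K * (ρ + ε)) := by
  obtain ⟨K, hK, hpath⟩ := D.exists_hasPath_of_tendsto_blockProd
  refine ⟨K, hK, fun z ρ h ε hε => ?_⟩
  set δ : ℕ → ℝ := fun k => ε / 8 * (1 / 2) ^ k with hδ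
  have hδ0 : ∀ k, 0 < δ k := fun k => by positivity
  have hδs : HasSum δ (ε / 4) := by
    have := hasSum_geometric_two.mul_left (ε / 8)
    rwa [show ε / 8 * 2 = ε / 4 by ring] at this
  have hN := D.adBounded_norm
  -- The first block uses up the `V`-cost `ρ`, while its error is already small in the full graph
  -- norm. The graph norms of its own exponents are finite but not bounded by `ρ`; only their
  -- `V`-norms enter the length.
  obtain ⟨l₀, hl₀, hr₀⟩ := h.exists_prodExp_left hN (f := fun v => ‖v‖)
    (fun r hr v => by rw [norm_smul, Real.norm_of_nonneg hr]) (fun v => norm_neg v)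
    (fun c hc η hη => by
      obtain ⟨v, hv⟩ := D.exists_pt_near hc hη
      refine ⟨v, hv, ?_⟩
      have h1 := (norm_fst_le (c - D.pt v)).trans hv
      rw [Prod.fst_sub, pt_fst] at h1
      have h2 := norm_le_norm_add_norm_sub' v c.1
      rw [norm_sub_rev] at h2
      rw [fstSeminorm_apply]
      linarith) (show 0 < min (δ 0) (ε / 2) from lt_min (hδ0 0) (by positivity))
  -- From here on remainders are small in the graph norm, so the following blocks have summable
  -- graph norms.
  have hstep : ∀ k (y : Bˣ), ∃ l : List V, D.Reach (normSeminorm ℝ (V × B)) y (δ k) →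
      (l.map fun v => ‖D.pt v‖).sum ≤ δ k + δ (k + 1) ∧
      D.Reach (normSeminorm ℝ (V × B)) ((D.prodExp l)⁻¹ * y) (δ (k + 1)) := by
    intro k y
    by_cases hy : D.Reach (normSeminorm ℝ (V × B)) y (δ k)
    · obtain ⟨l, hl⟩ := hy.exists_prodExp_left hN (f := fun v => ‖D.pt v‖)
        (fun r hr v => by rw [map_smul, norm_smul, Real.norm_of_nonneg hr])
        (fun v => by rw [map_neg, norm_neg])
        (fun c hc η hη => by
          obtain ⟨v, hv⟩ := D.exists_pt_near hc hη
          refine ⟨v, hv, ?_⟩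
          have h2 := norm_le_norm_add_norm_sub' (D.pt v) c
          rw [norm_sub_rev] at h2
          rw [coe_normSeminorm]
          linarith) (hδ0 (k + 1))
      exact ⟨l, fun _ => hl⟩
    · exact ⟨[], fun hy' => absurd hy' hy⟩
  choose F hF using hstep
  obtain ⟨y, hy0, hys⟩ : ∃ y : ℕ → Bˣ, y 0 = (D.prodExp l₀)⁻¹ * z ∧
      ∀ k, y (k + 1) = (D.prodExp (F k (y k)))⁻¹ * y k :=
    ⟨fun k => Nat.rec ((D.prodExp l₀)⁻¹ * z) (fun k y => (D.prodExp (F k y))⁻¹ * y) k, rfl,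
      fun _ => rfl⟩
  have hyr : ∀ k, D.Reach (normSeminorm ℝ (V × B)) (y k) (δ k) := by
    intro k
    induction k with
    | zero => rw [hy0]; exact hr₀.mono (min_le_left _ _)
    | succ k ih => rw [hys]; exact (hF k (y k) ih).2
  obtain ⟨L, hL0, hLs⟩ : ∃ L : ℕ → List V, L 0 = l₀ ∧ ∀ k, L (k + 1) = F k (y k) :=
    ⟨fun k => Nat.casesOn k l₀ fun k => F k (y k), rfl, fun _ => rfl⟩
  have hprod : ∀ k, D.blockProd L (k + 1) * y k = z := by
    intro k
    induction k with
    | zero => rw [blockProd_succ, blockProd_zero, hL0, hy0]; group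
    | succ k ih =>
      rw [blockProd_succ, hLs, hys, mul_assoc, mul_inv_cancel_left, ih]
  have hcost : ∀ k, ((L (k + 1)).map fun v => ‖D.pt v‖).sum ≤ 2 * δ k := by
    intro k
    have h1 := (hF k (y k) (hyr k)).1
    have h2 : δ (k + 1) ≤ δ k := by
      simp only [hδ, pow_succ]
      have := hδ0 k
      simp only [hδ] at this
      linarith
    rw [hLs]
    linarith
  have hsum : Summable fun k => ((L k).map fun v => ‖D.pt v‖).sum :=
    (summable_nat_add_iff 1).1 (Summable.of_nonneg_of_le (fun k => sum_map_norm_pt_nonneg _) hcost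
      (hδs.summable.mul_left 2))
  have hlim : Tendsto (fun k => (D.blockProd L k : B)) atTop (𝓝 (z : B)) := by
    refine (tendsto_add_atTop_iff_nat 1).1 ?_
    have h1 : Tendsto (fun k => (((y k)⁻¹ : Bˣ) : B)) atTop (𝓝 1) := by
      rw [tendsto_iff_norm_sub_tendsto_zero]
      refine squeeze_zero (fun _ => norm_nonneg _) (fun k => (hyr k).inv.norm_sub_one_le) ?_
      have : Tendsto (fun k => Real.exp (δ k)) atTop (𝓝 (Real.exp 0)) :=
        (Real.continuous_exp.tendsto _).comp hδs.summable.tendsto_atTop_zero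
      simpa using this.sub_const 1
    have h2 := h1.const_mul (z : B)
    rw [mul_one] at h2
    refine h2.congr fun k => ?_
    rw [← Units.val_mul]
    congr 1
    rw [← hprod k, mul_inv_cancel_right]
  refine (hpath L hsum z hlim).mono (mul_le_mul_of_nonneg_left ?_ hK)
  have hsum' : Summable fun k => ((L k).map fun v => ‖v‖).sum :=
    Summable.of_nonneg_of_le (fun k => List.sum_nonneg
      (by simp only [List.mem_map]; rintro _ ⟨x, -, rfl⟩; exact norm_nonneg _))
      (fun k => sum_map_norm_le _) hsum
  rw [hsum'.tsum_eq_zero_add, hL0]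
  have hle : ∑' k, ((L (k + 1)).map fun v => ‖v‖).sum ≤ 2 * (ε / 4) := by
    have h1 : Summable fun k => ((L (k + 1)).map fun v => ‖v‖).sum :=
      hsum'.comp_injective (add_left_injective 1)
    have h2 : HasSum (fun k => 2 * δ k) (2 * (ε / 4)) := hδs.mul_left 2
    rw [← h2.tsum_eq]
    exact h1.tsum_le_tsum (fun k => (sum_map_norm_le _).trans (hcost k)) h2.summable
  have := min_le_right (δ 0) (ε / 2)
  linarith

end LieRealization

/-! ### From piecewise smooth paths to reachability -/

theorem PiecewiseContinuous.comp_continuous {X Y : Type*} [TopologicalSpace X] [TopologicalSpace Y]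
    {S : Finset ℝ} {f : ℝ → X} (hf : PiecewiseContinuous S f) {φ : X → Y} (hφ : Continuous φ) :
    PiecewiseContinuous S fun τ => φ (f τ) :=
  ⟨fun τ hτ hS => hφ.continuousAt.comp_continuousWithinAt (hf.1 τ hτ hS),
    fun τ hτ => (hf.2.1 τ hτ).imp' φ fun l hl => (hφ.tendsto l).comp hl,
    fun τ hτ => (hf.2.2 τ hτ).imp' φ fun l hl => (hφ.tendsto l).comp hl⟩

theorem PiecewiseContinuous.prodMk {X Y : Type*} [TopologicalSpace X] [TopologicalSpace Y]
    {S : Finset ℝ} {f : ℝ → X} {g : ℝ → Y} (hf : PiecewiseContinuous S f)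
    (hg : PiecewiseContinuous S g) : PiecewiseContinuous S fun τ => (f τ, g τ) := by
  refine ⟨fun τ hτ hS => (hf.1 τ hτ hS).prodMk (hg.1 τ hτ hS), fun τ hτ => ?_, fun τ hτ => ?_⟩
  · obtain ⟨l, hl⟩ := hf.2.1 τ hτ
    obtain ⟨m, hm⟩ := hg.2.1 τ hτ
    exact ⟨(l, m), hl.prodMk_nhds hm⟩
  · obtain ⟨l, hl⟩ := hf.2.2 τ hτ
    obtain ⟨m, hm⟩ := hg.2.2 τ hτ
    exact ⟨(l, m), hl.prodMk_nhds hm⟩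

theorem Finset.eventually_notMem_nhdsNE (S : Finset ℝ) (τ : ℝ) : ∀ᶠ x in 𝓝[≠] τ, x ∉ S := by
  have h : (↑(S.erase τ) : Set ℝ)ᶜ ∈ 𝓝 τ :=
    (S.erase τ).finite_toSet.isClosed.isOpen_compl.mem_nhds (by simp)
  filter_upwards [mem_nhdsWithin_of_mem_nhds h, self_mem_nhdsWithin] with x hx hne hxS
  exact hx (Finset.mem_coe.2 (Finset.mem_erase.2 ⟨hne, hxS⟩))

theorem Finset.eventually_notMem_nhds {S : Finset ℝ} {τ : ℝ} (hτ : τ ∉ S) : ∀ᶠ x in 𝓝 τ, x ∉ S :=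
  S.finite_toSet.isClosed.isOpen_compl.mem_nhds hτ

namespace LieRealization

variable {V B : Type*} [NormedAddCommGroup V] [NormedSpace ℝ V] [CompleteSpace V]
  [NormedRing B] [NormedAlgebra ℝ B] [CompleteSpace B] {D : LieRealization V B}

theorem tendsto_units_inv {l : Filter ℝ} {g : ℝ → Bˣ} {u : Bˣ}
    (h : Tendsto (fun τ => (g τ : B)) l (𝓝 (u : B))) :
    Tendsto (fun τ => (((g τ)⁻¹ : Bˣ) : B)) l (𝓝 ((u⁻¹ : Bˣ) : B)) := by
  have h1 := (NormedRing.inverse_continuousAt u).tendsto.comp h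
  rw [Ring.inverse_unit] at h1
  exact h1.congr fun τ => Ring.inverse_unit _

variable {g : ℝ → Bˣ} {a : ℝ → V} {S : Finset ℝ} {dg : ℝ → B}

/-- The operator component is piecewise continuous because it equals `g⁻¹ ġ`, not through continuity
of `ι`. -/
theorem piecewiseContinuous_pt (hg : ContinuousOn (fun τ => (g τ : B)) (Icc 0 1))
    (hdg : PiecewiseContinuous S dg)
    (hι : ∀ τ ∈ Icc (0 : ℝ) 1, τ ∉ S → D.ι (a τ) = ((g τ)⁻¹ : Bˣ) * dg τ)
    (ha : PiecewiseContinuous S a) : PiecewiseContinuous S fun τ => D.pt (a τ) := by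
  have hsnd : PiecewiseContinuous S fun τ => D.ι (a τ) := by
    refine ⟨fun τ hτ hS => ?_, fun τ hτ => ?_, fun τ hτ => ?_⟩
    · have h1 := (tendsto_units_inv (hg τ hτ)).mul (hdg.1 τ hτ hS)
      rw [ContinuousWithinAt, hι τ hτ hS]
      refine h1.congr' ?_
      filter_upwards [self_mem_nhdsWithin,
        mem_nhdsWithin_of_mem_nhds (Finset.eventually_notMem_nhds hS)] with x hx hxS
      exact (hι x hx hxS).symm
    · obtain ⟨l, hl⟩ := hdg.2.1 τ hτ
      have hle : 𝓝[<] τ ≤ 𝓝[Icc 0 1] τ := by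
        rw [← nhdsWithin_Ioo_eq_nhdsLT hτ.1]
        exact nhdsWithin_mono _ fun x hx => ⟨hx.1.le, hx.2.le.trans hτ.2⟩
      refine ⟨_, ((tendsto_units_inv ((hg τ ⟨hτ.1.le, hτ.2⟩).mono_left hle)).mul hl).congr' ?_⟩
      filter_upwards [hle self_mem_nhdsWithin, (S.eventually_notMem_nhdsNE τ).filter_mono
        (nhdsWithin_mono _ fun x hx => ne_of_lt hx)] with x hx hxS
      exact (hι x hx hxS).symm
    · obtain ⟨l, hl⟩ := hdg.2.2 τ hτ
      have hle : 𝓝[>] τ ≤ 𝓝[Icc 0 1] τ := by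
        rw [← nhdsWithin_Ioo_eq_nhdsGT hτ.2]
        exact nhdsWithin_mono _ fun x hx => ⟨hτ.1.trans hx.1.le, hx.2.le⟩
      refine ⟨_, ((tendsto_units_inv ((hg τ ⟨hτ.1, hτ.2.le⟩).mono_left hle)).mul hl).congr' ?_⟩
      filter_upwards [hle self_mem_nhdsWithin, (S.eventually_notMem_nhdsNE τ).filter_mono
        (nhdsWithin_mono _ fun x hx => ne_of_gt hx)] with x hx hxS
      exact (hι x hx hxS).symm
  exact ha.prodMk hsnd

/-- Where `‖a‖` oscillates by at most `2 η`, the supremum bound used as cost exceeds the integral by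
at most `2 η (y - x)`. -/
theorem exists_reach_of_Ioo (hg : ContinuousOn (fun τ => (g τ : B)) (Icc 0 1))
    (hd : ∀ τ ∈ Icc (0 : ℝ) 1, τ ∉ S →
      HasDerivWithinAt (fun τ => (g τ : B)) (g τ * D.ι (a τ)) (Icc 0 1) τ)
    (ha : PiecewiseContinuous S fun τ => D.pt (a τ)) {x y : ℝ} (hx : 0 ≤ x) (hxy : x < y)
    (hy : y ≤ 1) (hS : ∀ τ ∈ Ioo x y, τ ∉ S) {R η : ℝ}
    (hR : ∀ τ ∈ Ioo x y, R - η ≤ ‖a τ‖ ∧ ‖a τ‖ ≤ R + η) :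
    ∃ r, D.Reach (fstSeminorm V B) ((g x)⁻¹ * g y) r ∧
      ENNReal.ofReal r ≤ (∫⁻ τ in Ioc x y, ‖a τ‖ₑ) + ENNReal.ofReal (2 * η * (y - x)) := by
  have hsub : Ioo x y ⊆ Icc 0 1 := fun τ hτ => ⟨hx.trans hτ.1.le, hτ.2.le.trans hy⟩
  have hyx : 0 < y - x := sub_pos.2 hxy
  have hη : 0 ≤ η := by
    obtain ⟨τ, hτ⟩ := nonempty_Ioo.2 hxy
    linarith [(hR τ hτ).1, (hR τ hτ).2]
  have hcont : ContinuousOn (fun τ => D.pt (a τ)) (Ioo x y) := fun τ hτ =>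
    (ha.1 τ (hsub hτ) (hS τ hτ)).mono hsub
  obtain ⟨l, hl⟩ := ha.2.2 x ⟨hx, hxy.trans_le hy⟩
  obtain ⟨m, hm⟩ := ha.2.1 y ⟨hx.trans_lt hxy, hy⟩
  -- At the ends the control takes its one-sided limits. These lie only in the closure of the graph,
  -- which is why controls are allowed there.
  set c := extendFrom (Ioo x y) fun τ => D.pt (a τ) with hc
  have hcc : ContinuousOn c (Icc x y) := continuousOn_Icc_extendFrom_Ioo hcont hl hm
  have hceq : ∀ τ ∈ Ioo x y, c τ = D.pt (a τ) := fun τ hτ =>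
    extendFrom_extends hcont τ hτ
  have hclosed : IsClosed {c : V × B | c ∈ D.graphClosure ∧ ‖c.1‖ ≤ R + η} :=
    D.isClosed_graphClosure.inter (isClosed_le continuous_fst.norm continuous_const)
  have hall : ∀ τ ∈ Icc x y, c τ ∈ D.graphClosure ∧ ‖(c τ).1‖ ≤ R + η := by
    intro τ hτ
    have hmaps : MapsTo c (Ioo x y) {c : V × B | c ∈ D.graphClosure ∧ ‖c.1‖ ≤ R + η} := by
      intro σ hσ
      rw [hceq σ hσ]
      exact ⟨D.pt_mem _, (hR σ hσ).2⟩
    have := ((hcc τ hτ).mono Ioo_subset_Icc_self).mem_closure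
      (by rwa [closure_Ioo hxy.ne]) hmaps
    rwa [hclosed.closure_eq] at this
  have hseg : D.IsSegment (fstSeminorm V B) (R + η) x y g c :=
    { cont_path := hg.mono (Icc_subset_Icc hx hy)
      cont_control := hcc
      mem := fun τ hτ => (hall τ hτ).1
      bound := fun τ hτ => (hall τ hτ).2
      deriv := fun τ hτ => by
        rw [hceq τ hτ, pt_snd]
        exact (hd τ (hsub hτ) (hS τ hτ)).hasDerivAt
          (Icc_mem_nhds (hx.trans_lt hτ.1) (hτ.2.trans_le hy)) }
  refine ⟨_, Reach.seg hxy.le hseg, ?_⟩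
  have hlow : ENNReal.ofReal ((R - η) * (y - x)) ≤ ∫⁻ τ in Ioc x y, ‖a τ‖ₑ := by
    calc ENNReal.ofReal ((R - η) * (y - x))
        = ∫⁻ _ in Ioo x y, ENNReal.ofReal (R - η) := by
          rw [setLIntegral_const, Real.volume_Ioo, ENNReal.ofReal_mul' hyx.le]
      _ ≤ ∫⁻ τ in Ioo x y, ‖a τ‖ₑ := by
          refine setLIntegral_mono' measurableSet_Ioo fun τ hτ => ?_
          rw [← ofReal_norm]
          exact ENNReal.ofReal_le_ofReal (hR τ hτ).1
      _ ≤ ∫⁻ τ in Ioc x y, ‖a τ‖ₑ := lintegral_mono_set Ioo_subset_Ioc_self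
  calc ENNReal.ofReal ((R + η) * (y - x))
      = ENNReal.ofReal ((R - η) * (y - x) + 2 * η * (y - x)) := by ring_nf
    _ ≤ ENNReal.ofReal ((R - η) * (y - x)) + ENNReal.ofReal (2 * η * (y - x)) :=
        ENNReal.ofReal_add_le
    _ ≤ _ := by gcongr

/-- The end points of a path in `C¹_CM` of length less than `ρ` differ by an element that can be
reached with cost `ρ`. -/
theorem reach_of_path (hg : ContinuousOn (fun τ => (g τ : B)) (Icc 0 1))
    (hd : ∀ τ ∈ Icc (0 : ℝ) 1, τ ∉ S →
      HasDerivWithinAt (fun τ => (g τ : B)) (g τ * D.ι (a τ)) (Icc 0 1) τ)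
    (ha : PiecewiseContinuous S fun τ => D.pt (a τ)) {ρ : ℝ}
    (hρ : ∫⁻ τ in Icc (0 : ℝ) 1, ‖a τ‖ₑ < ENNReal.ofReal ρ) :
    D.Reach (fstSeminorm V B) ((g 0)⁻¹ * g 1) ρ := by
  obtain ⟨ρ', hρ'1, hρ'2⟩ : ∃ ρ' : ℝ, ∫⁻ τ in Icc (0 : ℝ) 1, ‖a τ‖ₑ ≤ ENNReal.ofReal ρ' ∧
      0 ≤ ρ' ∧ ρ' < ρ := by
    set I := ∫⁻ τ in Icc (0 : ℝ) 1, ‖a τ‖ₑ with hI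
    have htop : I ≠ ⊤ := (hρ.trans ENNReal.ofReal_lt_top).ne
    refine ⟨I.toReal, (ENNReal.ofReal_toReal htop).ge, ENNReal.toReal_nonneg, ?_⟩
    have hρ0 : 0 < ρ := ENNReal.ofReal_pos.1 ((zero_le).trans_lt hρ)
    exact (ENNReal.lt_ofReal_iff_toReal_lt htop).1 hρ
  obtain ⟨hρ'0, hρ'ρ⟩ := hρ'2
  set η := (ρ - ρ') / 2 with hη
  have hη0 : 0 < η := by rw [hη]; linarith
  have key : ∃ r, D.Reach (fstSeminorm V B) ((g 0)⁻¹ * g 1) r ∧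
      ENNReal.ofReal r ≤ (∫⁻ τ in Ioc (0 : ℝ) 1, ‖a τ‖ₑ) + ENNReal.ofReal (2 * η * (1 - 0)) := by
    have hrefl : ∀ x, ∃ r, D.Reach (fstSeminorm V B) ((g x)⁻¹ * g x) r ∧
        ENNReal.ofReal r ≤ (∫⁻ τ in Ioc x x, ‖a τ‖ₑ) + ENNReal.ofReal (2 * η * (x - x)) :=
      fun x => ⟨0, by rw [inv_mul_cancel]; exact reach_one le_rfl, by simp⟩
    -- Each point has punctured one-sided neighbourhoods free of break points on which `‖a‖` is
    -- nearly constant; costs and integrals both add up.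
    refine interval_induction (Q := fun x y => ∃ r, D.Reach (fstSeminorm V B) ((g x)⁻¹ * g y) r ∧
      ENNReal.ofReal r ≤ (∫⁻ τ in Ioc x y, ‖a τ‖ₑ) + ENNReal.ofReal (2 * η * (y - x)))
      zero_le_one ?_ ?_
    · intro x hx
      have hnear : ∀ {l : V × B} {F : Filter ℝ}, Tendsto (fun τ => D.pt (a τ)) F (𝓝 l) →
          F ≤ 𝓝[≠] x → ∀ᶠ τ in F, τ ∉ S ∧ ‖l.1‖ - η ≤ ‖a τ‖ ∧ ‖a τ‖ ≤ ‖l.1‖ + η := by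
        intro l F hl hF
        have h1 : Tendsto (fun τ => ‖a τ‖) F (𝓝 ‖l.1‖) :=
          ((continuous_fst.norm).tendsto l).comp hl
        filter_upwards [(S.eventually_notMem_nhdsNE x).filter_mono hF,
          h1.eventually (Icc_mem_nhds (show ‖l.1‖ - η < ‖l.1‖ by linarith)
            (show ‖l.1‖ < ‖l.1‖ + η by linarith))] with τ h1 h2 using ⟨h1, h2⟩
      have hright : ∃ h > 0, ∀ y ∈ Icc (0 : ℝ) 1, x ≤ y → y < x + h →
          ∃ r, D.Reach (fstSeminorm V B) ((g x)⁻¹ * g y) r ∧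
          ENNReal.ofReal r ≤ (∫⁻ τ in Ioc x y, ‖a τ‖ₑ) + ENNReal.ofReal (2 * η * (y - x)) := by
        rcases hx.2.eq_or_lt with rfl | hlt
        · refine ⟨1, one_pos, fun y hy hxy _ => ?_⟩
          obtain rfl : y = 1 := le_antisymm hy.2 hxy
          exact hrefl 1
        · obtain ⟨l, hl⟩ := ha.2.2 x ⟨hx.1, hlt⟩
          have hev := hnear hl (nhdsWithin_mono _ fun _ h => ne_of_gt h)
          obtain ⟨u, hu, hsub⟩ := mem_nhdsGT_iff_exists_Ioo_subset.1 hev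
          have hu' : x < u := hu
          refine ⟨u - x, by linarith, fun y hy hxy hyu => ?_⟩
          rcases hxy.eq_or_lt with rfl | hxy
          · exact hrefl x
          have hsub' : ∀ τ ∈ Ioo x y, τ ∈ Ioo x u := fun τ hτ => ⟨hτ.1, by linarith [hτ.2]⟩
          exact exists_reach_of_Ioo hg hd ha hx.1 hxy hy.2 (fun τ hτ => (hsub (hsub' τ hτ)).1)
            fun τ hτ => (hsub (hsub' τ hτ)).2
      have hleft : ∃ h > 0, ∀ y ∈ Icc (0 : ℝ) 1, x - h < y → y ≤ x →
          ∃ r, D.Reach (fstSeminorm V B) ((g y)⁻¹ * g x) r ∧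
          ENNReal.ofReal r ≤ (∫⁻ τ in Ioc y x, ‖a τ‖ₑ) + ENNReal.ofReal (2 * η * (x - y)) := by
        rcases hx.1.eq_or_lt with rfl | hlt
        · refine ⟨1, one_pos, fun y hy _ hyx => ?_⟩
          obtain rfl : y = 0 := le_antisymm hyx hy.1
          exact hrefl 0
        · obtain ⟨l, hl⟩ := ha.2.1 x ⟨hlt, hx.2⟩
          have hev := hnear hl (nhdsWithin_mono _ fun _ h => ne_of_lt h)
          obtain ⟨u, hu, hsub⟩ := mem_nhdsLT_iff_exists_Ioo_subset.1 hev
          have hu' : u < x := hu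
          refine ⟨x - u, by linarith, fun y hy hyu hyx => ?_⟩
          rcases hyx.eq_or_lt with rfl | hyx
          · exact hrefl y
          have hsub' : ∀ τ ∈ Ioo y x, τ ∈ Ioo u x := fun τ hτ => ⟨by linarith [hτ.1], hτ.2⟩
          exact exists_reach_of_Ioo hg hd ha hy.1 hyx hx.2 (fun τ hτ => (hsub (hsub' τ hτ)).1)
            fun τ hτ => (hsub (hsub' τ hτ)).2
      obtain ⟨h, hh, hr⟩ := hright
      obtain ⟨h', hh', hl⟩ := hleft
      exact ⟨min h h', lt_min hh hh',
        fun y hy hxy hyh => hr y hy hxy (hyh.trans_le (by linarith [min_le_left h h'])),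
        fun y hy hyh hyx => hl y hy (by linarith [min_le_right h h']) hyx⟩
    · rintro x y w hx hxy hyw hw ⟨r, hr, hrle⟩ ⟨r', hr', hrle'⟩
      refine ⟨r + r', ?_, ?_⟩
      · have := hr.mul hr'
        rwa [mul_assoc, mul_inv_cancel_left] at this
      · rw [ENNReal.ofReal_add hr.nonneg hr'.nonneg]
        have h1 : ∫⁻ τ in Ioc x w, ‖a τ‖ₑ =
            (∫⁻ τ in Ioc x y, ‖a τ‖ₑ) + ∫⁻ τ in Ioc y w, ‖a τ‖ₑ := by
          rw [← Ioc_union_Ioc_eq_Ioc hxy hyw,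
            lintegral_union measurableSet_Ioc (Ioc_disjoint_Ioc_of_le le_rfl)]
        have h2 : ENNReal.ofReal (2 * η * (w - x)) =
            ENNReal.ofReal (2 * η * (y - x)) + ENNReal.ofReal (2 * η * (w - y)) := by
          rw [← ENNReal.ofReal_add (mul_nonneg (by positivity) (sub_nonneg.2 hxy))
            (mul_nonneg (by positivity) (sub_nonneg.2 hyw))]
          ring_nf
        rw [h1, h2, add_add_add_comm]
        exact add_le_add hrle hrle'
  obtain ⟨r, hr, hrle⟩ := key
  refine hr.mono ?_
  have h1 : ENNReal.ofReal r ≤ ENNReal.ofReal ρ := by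
    refine hrle.trans ?_
    have h2 : ∫⁻ τ in Ioc (0 : ℝ) 1, ‖a τ‖ₑ ≤ ENNReal.ofReal ρ' :=
      (lintegral_mono_set Ioc_subset_Icc_self).trans hρ'1
    refine (add_le_add_left h2 _).trans ?_
    rw [← ENNReal.ofReal_add hρ'0 (by linarith)]
    exact ENNReal.ofReal_le_ofReal (by rw [hη]; linarith)
  exact (ENNReal.ofReal_le_ofReal_iff (hρ'0.trans hρ'ρ.le)).1 h1

theorem HasPath.reach {z : Bˣ} {ℓ ℓ' : ℝ} (h : D.HasPath z ℓ) (hlt : ℓ < ℓ') (h0 : 0 < ℓ') :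
    D.Reach (fstSeminorm V B) z ℓ' := by
  obtain ⟨g, a, h1, h2, h3, h4, h5, h6⟩ := h
  have := reach_of_path h1 h4 h5 (h6.trans_lt ((ENNReal.ofReal_lt_ofReal_iff h0).2 hlt))
  rwa [h2, h3, inv_one, one_mul] at this

/-! ### Convergence of rapidly Cauchy sequences -/

/-- An element that can be reached is approximated by products of exponentials of elements of `V`
whose graph norms are controlled. -/
theorem exists_prodExp_norm_pt_le (D : LieRealization V B) :
    ∃ M : ℝ, 0 ≤ M ∧ ∀ (z : Bˣ) (ρ : ℝ), D.Reach (fstSeminorm V B) z ρ → ∀ ε > 0,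
      ∃ l : List V, (l.map fun v => ‖D.pt v‖).sum ≤ M * (ρ + ε) ∧
        D.Reach (fstSeminorm V B) ((D.prodExp l)⁻¹ * z) ε := by
  obtain ⟨M, hM, hnear⟩ := D.exists_near_norm_ι_le
  have hM1 : 0 < M + 1 := by linarith
  refine ⟨M + 1, hM1.le, fun z ρ h ε hε => ?_⟩
  -- The error is measured in `V` only, so the operator component of the control may be discarded
  -- and a nearby vector with bounded image used instead. The factor `(M + 1)⁻¹` makes the graph
  -- norm of that vector comparable with the `V`-cost.
  obtain ⟨l, hl, hr⟩ := h.exists_prodExp_left D.adBounded_fst (f := fun v => ‖D.pt v‖ * (M + 1)⁻¹)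
    (fun r hr v => by rw [map_smul, norm_smul, Real.norm_of_nonneg hr, mul_assoc])
    (fun v => by rw [map_neg, norm_neg])
    (fun c _ η hη => by
      obtain ⟨v, hv, hvM⟩ := hnear c.1 η hη
      refine ⟨v, hv, ?_⟩
      rw [← div_eq_mul_inv, div_le_iff₀ hM1, fstSeminorm_apply, Prod.norm_def, pt_fst, pt_snd]
      have h2 := norm_le_norm_add_norm_sub' v c.1
      rw [norm_sub_rev] at h2
      have h3 := norm_nonneg c.1
      refine max_le ?_ ?_ <;> nlinarith) hε
  refine ⟨l, ?_, hr⟩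
  have h1 : (l.map fun v => ‖D.pt v‖ * (M + 1)⁻¹).sum =
      (l.map fun v => ‖D.pt v‖).sum * (M + 1)⁻¹ :=
    List.sum_map_mul_right _ _ _
  rw [h1, ← div_eq_mul_inv, div_le_iff₀ hM1] at hl
  linarith

/-- Completeness: a sequence whose successive quotients are reached with geometrically decreasing
costs converges. -/
theorem exists_limit (D : LieRealization V B) {u : ℕ → Bˣ}
    (hu : ∀ k, D.Reach (fstSeminorm V B) ((u k)⁻¹ * u (k + 1)) ((1 / 2) ^ k)) :
    ∃ x : Bˣ, ∀ ε > 0, ∀ᶠ k in atTop, D.Reach (fstSeminorm V B) ((u k)⁻¹ * x) ε := by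
  obtain ⟨M, hM, happrox⟩ := D.exists_prodExp_norm_pt_le
  obtain ⟨K, hK, hpath⟩ := D.exists_hasPath_of_tendsto_blockProd
  have hδ : ∀ k : ℕ, (0 : ℝ) < (1 / 2) ^ k := fun k => by positivity
  -- A shadow sequence `y` follows `u` within cost `(1 / 2) ^ k`, but moves by exponentials with
  -- summable graph norms. The cost to cover is the old error plus the increment of `u` plus the new
  -- tolerance, at most `3 * (1 / 2) ^ k`.
  have hstep : ∀ k (y : Bˣ), ∃ l : List V,
      D.Reach (fstSeminorm V B) (y⁻¹ * u k) ((1 / 2) ^ k) →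
      (l.map fun v => ‖D.pt v‖).sum ≤ M * (3 * (1 / 2) ^ k) ∧
      D.Reach (fstSeminorm V B) ((y * D.prodExp l)⁻¹ * u (k + 1)) ((1 / 2) ^ (k + 1)) := by
    intro k y
    by_cases hy : D.Reach (fstSeminorm V B) (y⁻¹ * u k) ((1 / 2) ^ k)
    · have h1 := hy.mul (hu k)
      rw [mul_assoc, mul_inv_cancel_left] at h1
      obtain ⟨l, hl, hr⟩ := happrox _ _ h1 _ (hδ (k + 1))
      refine ⟨l, fun _ => ⟨hl.trans (mul_le_mul_of_nonneg_left ?_ hM), ?_⟩⟩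
      · have := hδ k
        rw [pow_succ]
        linarith
      · rwa [mul_inv_rev, mul_assoc]
    · exact ⟨[], fun hy' => absurd hy' hy⟩
  choose F hF using hstep
  obtain ⟨y, hy0, hys⟩ : ∃ y : ℕ → Bˣ, y 0 = u 0 ∧ ∀ k, y (k + 1) = y k * D.prodExp (F k (y k)) :=
    ⟨fun k => Nat.rec (u 0) (fun k y => y * D.prodExp (F k y)) k, rfl, fun _ => rfl⟩
  have hyr : ∀ k, D.Reach (fstSeminorm V B) ((y k)⁻¹ * u k) ((1 / 2) ^ k) := by
    intro k
    induction k with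
    | zero => rw [hy0, inv_mul_cancel]; exact reach_one (hδ 0).le
    | succ k ih => rw [hys]; exact (hF k (y k) ih).2
  obtain ⟨L, hL⟩ : ∃ L : ℕ → List V, ∀ k, L k = F k (y k) := ⟨_, fun _ => rfl⟩
  have hcost : ∀ k, ((L k).map fun v => ‖D.pt v‖).sum ≤ M * (3 * (1 / 2) ^ k) := fun k => by
    rw [hL]; exact (hF k (y k) (hyr k)).1
  have hsum : Summable fun k => ((L k).map fun v => ‖D.pt v‖).sum :=
    Summable.of_nonneg_of_le (fun k => sum_map_norm_pt_nonneg _) hcost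
      ((summable_geometric_two.mul_left 3).mul_left M)
  have hyL : ∀ k, y k = u 0 * D.blockProd L k := by
    intro k
    induction k with
    | zero => rw [hy0, blockProd_zero, mul_one]
    | succ k ih => rw [hys, ih, blockProd_succ, hL, ih, mul_assoc]
  obtain ⟨z, hz⟩ := D.exists_tendsto_blockProd hsum
  refine ⟨u 0 * z, fun ε hε => ?_⟩
  -- The tail of a convergent product is again one, so its path length is bounded by the tail of the
  -- series and tends to `0`.
  have htail : ∀ k, D.HasPath ((y k)⁻¹ * (u 0 * z))
      (K * ∑' i, ((L (k + i)).map fun v => ‖v‖).sum) := by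
    intro k
    refine hpath (fun i => L (k + i)) (hsum.comp_injective (add_right_injective k)) _ ?_
    have h1 : Tendsto (fun j => (D.blockProd L (k + j) : B)) atTop (𝓝 (z : B)) :=
      hz.comp (tendsto_add_atTop_nat k |>.congr fun j => add_comm j k)
    have h2 := h1.const_mul (((D.blockProd L k)⁻¹ : Bˣ) : B)
    have h3 : (y k)⁻¹ * (u 0 * z) = (D.blockProd L k)⁻¹ * z := by rw [hyL]; group
    rw [h3, Units.val_mul]
    refine h2.congr fun j => ?_
    rw [blockProd_add, Units.val_mul, Units.inv_mul_cancel_left]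
  have hlim : Tendsto (fun k => K * ∑' i, ((L (k + i)).map fun v => ‖v‖).sum) atTop (𝓝 0) := by
    have := (tendsto_sum_nat_add fun k => ((L k).map fun v => ‖v‖).sum).const_mul K
    simpa only [mul_zero, add_comm] using this
  have hpow : Tendsto (fun k : ℕ => ((1 : ℝ) / 2) ^ k) atTop (𝓝 0) :=
    tendsto_pow_atTop_nhds_zero_of_lt_one (by norm_num) (by norm_num)
  filter_upwards [hlim.eventually (gt_mem_nhds (half_pos hε)),
    hpow.eventually (gt_mem_nhds (half_pos hε))] with k h1 h2
  have h3 := ((hyr k).inv.mono (le_of_lt h2)).mul ((htail k).reach h1 (half_pos hε))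
  rw [add_halves] at h3
  convert h3 using 1
  group

end LieRealization

/-! ### Lie subgroups of the invertible operators -/

section RealAlgebra

variable {𝕜 : Type*} [RCLike 𝕜] {H : Type*} [NormedAddCommGroup H]
  [InnerProductSpace 𝕜 H] [NormedSpace ℝ H] [IsScalarTower ℝ 𝕜 H]

/-- The bounded operators on a real or complex Hilbert space as a real normed algebra. -/
@[reducible]
noncomputable def realNormedAlgebra : NormedAlgebra ℝ (H →L[𝕜] H) where
  __ := Algebra.ofModule (R := ℝ) (A := H →L[𝕜] H) (fun r x y => by ext; simp)
    (fun r x y => by ext; simp)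
  norm_smul_le r x := norm_smul_le r x

end RealAlgebra

section OperatorAlgebra

attribute [local instance] realNormedAlgebra

namespace ConnectedLieSubgroup

variable {𝕜 : Type*} [RCLike 𝕜] {H : Type*} [NormedAddCommGroup H]
  [InnerProductSpace 𝕜 H] [NormedSpace ℝ H] [IsScalarTower ℝ 𝕜 H] [CompleteSpace H]
  (K : ConnectedLieSubgroup 𝕜 H)

/-- The inclusion of a Lie subgroup into the algebra of bounded operators. -/
def incl (g : K.carrier) : H →L[𝕜] H := ((g : (H →L[𝕜] H)ˣ) : H →L[𝕜] H)

theorem contMDiff_incl : ContMDiff (𝓡 K.dim) 𝓘(ℝ, H →L[𝕜] H) ∞ K.incl := K.smooth_incl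

theorem mdifferentiableAt_incl (g : K.carrier) :
    MDifferentiableAt (𝓡 K.dim) 𝓘(ℝ, H →L[𝕜] H) K.incl g :=
  (K.contMDiff_incl g).mdifferentiableAt (by simp)

theorem mdifferentiableAt_mul_left (g h : K.carrier) :
    MDifferentiableAt (𝓡 K.dim) (𝓡 K.dim) (g * ·) h :=
  (contMDiff_mul_left (I := 𝓡 K.dim) (n := ∞) (a := g) h).mdifferentiableAt (by simp)

/-- The differential of the inclusion. -/
noncomputable def dIncl (g : K.carrier) : EuclideanSpace ℝ (Fin K.dim) →L[ℝ] (H →L[𝕜] H) :=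
  mfderiv (𝓡 K.dim) 𝓘(ℝ, H →L[𝕜] H) K.incl g

/-- The differential of the left translation by `g` at `h`. -/
noncomputable def dMulLeft (g h : K.carrier) :
    EuclideanSpace ℝ (Fin K.dim) →L[ℝ] EuclideanSpace ℝ (Fin K.dim) :=
  mfderiv (𝓡 K.dim) (𝓡 K.dim) (g * ·) h

theorem mem_lieAlgebra_iff {X : H →L[𝕜] H} : X ∈ K.lieAlgebra ↔ ∃ w, K.dIncl 1 w = X := Iff.rfl

/-- Inclusion turns left translation into left multiplication, which is linear; differentiate both
sides. Consequently logarithmic derivatives of curves in the group lie in its Lie algebra. -/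
theorem dIncl_dMulLeft (g h : K.carrier) (w : EuclideanSpace ℝ (Fin K.dim)) :
    K.dIncl (g * h) (K.dMulLeft g h w) = K.incl g * K.dIncl h w := by
  have h1 : HasMFDerivAt (𝓡 K.dim) 𝓘(ℝ, H →L[𝕜] H) (K.incl ∘ (g * ·)) h
      ((K.dIncl (g * h)).comp (K.dMulLeft g h)) :=
    HasMFDerivAt.comp h (K.mdifferentiableAt_incl (g * h)).hasMFDerivAt
      (K.mdifferentiableAt_mul_left g h).hasMFDerivAt
  have h2 : HasMFDerivAt (𝓡 K.dim) 𝓘(ℝ, H →L[𝕜] H)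
      ((ContinuousLinearMap.mul ℝ (H →L[𝕜] H) (K.incl g)) ∘ K.incl) h
      ((ContinuousLinearMap.mul ℝ (H →L[𝕜] H) (K.incl g)).comp (K.dIncl h)) :=
    HasMFDerivAt.comp h
      (ContinuousLinearMap.mul ℝ (H →L[𝕜] H) (K.incl g)).hasMFDerivAt
      (K.mdifferentiableAt_incl h).hasMFDerivAt
  have h3 := hasMFDerivAt_unique h1 h2
  exact DFunLike.congr_fun h3 w

theorem inv_mul_dIncl_mem (g : K.carrier) (w : EuclideanSpace ℝ (Fin K.dim)) :
    K.incl g⁻¹ * K.dIncl g w ∈ K.lieAlgebra := by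
  rw [← dIncl_dMulLeft, inv_mul_cancel]
  exact ⟨_, rfl⟩

/-- An integral curve of the left-invariant field through `1` stays in the group, and its image
solves `f' = f X`, so it coincides with `exp (t X)` for small `t`. -/
theorem exists_expUnit_smul_mem {X : H →L[𝕜] H} (hX : X ∈ K.lieAlgebra) :
    ∃ ε > 0, ∀ t : ℝ, |t| < ε → expUnit (t • X) ∈ K.carrier := by
  obtain ⟨w, rfl⟩ := K.mem_lieAlgebra_iff.1 hX
  set X := K.dIncl 1 w with hXdef
  have : LieGroup (𝓡 K.dim) (minSmoothness ℝ 3) K.carrier :=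
    LieGroup.of_le (n := ∞) (by
      rw [minSmoothness_of_isRCLikeNormedField]
      exact WithTop.coe_le_coe.2 (le_top : (3 : ℕ∞) ≤ ⊤))
  have : IsManifold (𝓡 K.dim) 1 K.carrier := IsManifold.of_le (n := ∞) (by simp)
  have hv := (contMDiff_mulInvariantVectorField (I := 𝓡 K.dim) (G := K.carrier) w).contMDiffAt
    (x := 1)
  obtain ⟨γ, hγ0, hγ⟩ := exists_isMIntegralCurveAt_of_contMDiffAt_boundaryless (t₀ := 0)
    (hv.of_le (by simp))
  have hder : ∀ᶠ t in 𝓝 (0 : ℝ), HasDerivAt (fun t => K.incl (γ t)) (K.incl (γ t) * X) t := by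
    filter_upwards [hγ] with t ht
    have h1 := HasMFDerivAt.comp t (K.mdifferentiableAt_incl (γ t)).hasMFDerivAt ht
    have h2 : HasFDerivAt (fun t => K.incl (γ t)) ((K.dIncl (γ t)).comp
        ((1 : ℝ →L[ℝ] ℝ).smulRight (K.dMulLeft (γ t) 1 w))) t := hasMFDerivAt_iff_hasFDerivAt.1 h1
    refine h2.hasDerivAt.congr_deriv ?_
    have h3 := K.dIncl_dMulLeft (γ t) 1 w
    rw [mul_one] at h3
    rw [← h3]
    simp
  obtain ⟨ε, hε, hball⟩ := Metric.eventually_nhds_iff_ball.1 hder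
  refine ⟨ε, hε, fun t ht => ?_⟩
  set f : ℝ → (H →L[𝕜] H) := fun t => K.incl (γ t) * NormedSpace.exp (t • (-X)) with hf
  have hfd : ∀ t ∈ Metric.ball (0 : ℝ) ε, HasDerivAt f 0 t := by
    intro t ht
    refine ((hball t ht).mul (hasDerivAt_exp_smul_const' (-X) t)).congr_deriv ?_
    simp [mul_assoc]
  have htb : t ∈ Metric.ball (0 : ℝ) ε := by simpa using ht
  have hconst : f t = f 0 := Metric.isOpen_ball.is_const_of_deriv_eq_zero
    (convex_ball (0 : ℝ) ε).isPreconnected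
    (fun s hs => (hfd s hs).differentiableAt.differentiableWithinAt)
    (fun s hs => (hfd s hs).deriv) htb (Metric.mem_ball_self hε)
  have hf0 : f 0 = 1 := by
    simp only [hf, hγ0, zero_smul, NormedSpace.exp_zero, mul_one]
    rfl
  rw [hf0] at hconst
  have hinv : NormedSpace.exp (t • (-X)) = (((expUnit (t • X))⁻¹ : (H →L[𝕜] H)ˣ) : H →L[𝕜] H) := by
    rw [coe_expUnit_inv, smul_neg]
  have heq : ((γ t : K.carrier) : (H →L[𝕜] H)ˣ) = expUnit (t • X) := by
    rw [← mul_inv_eq_one]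
    ext1
    rw [Units.val_mul, ← hinv]
    exact hconst
  rw [← heq]
  exact (γ t).2

theorem expUnit_mem {X : H →L[𝕜] H} (hX : X ∈ K.lieAlgebra) : expUnit X ∈ K.carrier := by
  obtain ⟨ε, hε, h⟩ := K.exists_expUnit_smul_mem hX
  obtain ⟨n, hn⟩ := exists_nat_gt (1 / ε)
  have hn0 : (0 : ℝ) < n := (by positivity : (0 : ℝ) < 1 / ε).trans hn
  have h1 : expUnit ((n : ℝ)⁻¹ • X) ∈ K.carrier := h _ (by
    rw [abs_of_pos (inv_pos.2 hn0), ← one_div, div_lt_iff₀ hn0]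
    rw [div_lt_iff₀ hε] at hn
    linarith)
  have h2 := K.carrier.pow_mem h1 n
  rw [← expUnit_nsmul] at h2
  have h3 : n • ((n : ℝ)⁻¹ • X) = X := by
    rw [← Nat.cast_smul_eq_nsmul ℝ, smul_inv_smul₀ hn0.ne']
  rwa [h3] at h2

variable {V : Type*} [NormedAddCommGroup V] [NormedSpace ℝ V] [CompleteSpace V]
  (D : LieRealization V (H →L[𝕜] H))

open LieRealization

/-- Join `1` to a nearby point by a straight segment in a chart. Its logarithmic derivative is
continuous in the finite-dimensional Lie algebra, where `ι⁻¹` is automatically continuous, so it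
gives a continuous control in `V`. -/
theorem eventually_reach (hι : Function.Injective D.ι)
    (hsub : ∀ X ∈ K.lieAlgebra, ∃ v, D.ι v = X) :
    ∀ᶠ x : K.carrier in 𝓝 1, ∃ ρ, D.Reach (fstSeminorm V (H →L[𝕜] H)) (x : (H →L[𝕜] H)ˣ) ρ := by
  have : IsManifold (𝓡 K.dim) ∞ K.carrier := inferInstance
  set φ := extChartAt (𝓡 K.dim) (1 : K.carrier) with hφ
  have hopen : IsOpen φ.target := isOpen_extChartAt_target 1
  obtain ⟨r, hr, hball⟩ := Metric.isOpen_iff.1 hopen (φ 1) (mem_extChartAt_target 1)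
  have hsource : φ.source ∈ 𝓝 (1 : K.carrier) := extChartAt_source_mem_nhds 1
  have hpre : φ ⁻¹' Metric.ball (φ 1) r ∈ 𝓝 (1 : K.carrier) :=
    (continuousAt_extChartAt 1).preimage_mem_nhds (Metric.ball_mem_nhds _ hr)
  set F : EuclideanSpace ℝ (Fin K.dim) → (H →L[𝕜] H) := fun e => K.incl (φ.symm e) with hF
  have hFs : ContDiffOn ℝ ∞ F φ.target := by
    rw [← contMDiffOn_iff_contDiffOn]
    exact K.contMDiff_incl.comp_contMDiffOn (contMDiffOn_extChartAt_symm 1)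
  have hFd : ∀ e ∈ φ.target, DifferentiableAt ℝ F e := fun e he =>
    (hFs.contDiffAt (hopen.mem_nhds he)).differentiableAt (by simp)
  have hFmem : ∀ e ∈ φ.target, ∀ u, K.incl (φ.symm e)⁻¹ * fderiv ℝ F e u ∈ K.lieAlgebra := by
    intro e he u
    have h1 : MDifferentiableAt 𝓘(ℝ, EuclideanSpace ℝ (Fin K.dim)) (𝓡 K.dim) φ.symm e :=
      ((contMDiffOn_extChartAt_symm (I := 𝓡 K.dim) (n := ∞) (1 : K.carrier)).contMDiffAt
        (hopen.mem_nhds he)).mdifferentiableAt (by simp)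
    have h2 := HasMFDerivAt.comp e (K.mdifferentiableAt_incl (φ.symm e)).hasMFDerivAt
      h1.hasMFDerivAt
    obtain ⟨A, hA⟩ : ∃ A : EuclideanSpace ℝ (Fin K.dim) →L[ℝ] EuclideanSpace ℝ (Fin K.dim),
        A = mfderiv 𝓘(ℝ, EuclideanSpace ℝ (Fin K.dim)) (𝓡 K.dim) φ.symm e := ⟨_, rfl⟩
    rw [← hA] at h2
    have h3 : HasFDerivAt F ((K.dIncl (φ.symm e)).comp A) e := hasMFDerivAt_iff_hasFDerivAt.1 h2
    rw [h3.fderiv]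
    exact K.inv_mul_dIncl_mem _ _
  have hfin : FiniteDimensional ℝ K.lieAlgebra := by
    have : FiniteDimensional ℝ (LinearMap.range (K.dIncl 1).toLinearMap) := inferInstance
    exact this
  choose! j hj using hsub
  obtain ⟨J, hJ⟩ : ∃ J : K.lieAlgebra →ₗ[ℝ] V, ∀ X, D.ι (J X) = X :=
    ⟨{ toFun := fun X => j X
       map_add' := fun X Y => hι (by
        rw [map_add, hj _ X.2, hj _ Y.2, hj _ (X + Y).2]; rfl)
       map_smul' := fun a X => hι (by
        rw [map_smul, hj _ X.2, hj _ (a • X).2]; rfl) }, fun X => hj _ X.2⟩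
  have hJc : Continuous J := J.continuous_of_finiteDimensional
  filter_upwards [hsource, hpre] with x hx hxr
  set u := φ x - φ 1 with hu
  set line : ℝ → EuclideanSpace ℝ (Fin K.dim) := fun τ => φ 1 + τ • u with hline
  have hlmem : ∀ τ ∈ Icc (0 : ℝ) 1, line τ ∈ φ.target := fun τ hτ =>
    hball ((convex_ball (φ 1) r).add_smul_sub_mem (Metric.mem_ball_self hr) hxr hτ)
  have hlc : Continuous line := continuous_const.add (continuous_id.smul continuous_const)
  have hld : ∀ τ, HasDerivAt line u τ := fun τ => by
    have := ((hasDerivAt_id τ).smul_const u).const_add (φ 1)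
    rwa [one_smul] at this
  set p : ℝ → (H →L[𝕜] H)ˣ := fun τ => (φ.symm (line τ) : K.carrier) with hp
  have hpc : ContinuousOn (fun τ => (p τ : H →L[𝕜] H)) (Icc 0 1) :=
    hFs.continuousOn.comp hlc.continuousOn hlmem
  have hpder : ∀ τ ∈ Icc (0 : ℝ) 1,
      HasDerivAt (fun τ => (p τ : H →L[𝕜] H)) (fderiv ℝ F (line τ) u) τ := fun τ hτ =>
    (hFd _ (hlmem τ hτ)).hasFDerivAt.comp_hasDerivAt τ (hld τ)
  set b : ℝ → (H →L[𝕜] H) := fun τ => ((p τ)⁻¹ : (H →L[𝕜] H)ˣ) * fderiv ℝ F (line τ) u with hb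
  have hbmem : ∀ τ ∈ Icc (0 : ℝ) 1, b τ ∈ K.lieAlgebra := fun τ hτ => hFmem _ (hlmem τ hτ) u
  have hbc : ContinuousOn b (Icc 0 1) := by
    refine ContinuousOn.mul (fun τ hτ => tendsto_units_inv (hpc τ hτ)) ?_
    exact ((hFs.continuousOn_fderiv_of_isOpen hopen (by simp)).comp hlc.continuousOn
      hlmem).clm_apply continuousOn_const
  classical
  set a : ℝ → V := fun τ => if h : b τ ∈ K.lieAlgebra then J ⟨b τ, h⟩ else 0 with ha
  have hac : ContinuousOn a (Icc 0 1) := by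
    rw [continuousOn_iff_continuous_domRestrict] at hbc ⊢
    have h1 : (Icc (0 : ℝ) 1).domRestrict a =
        fun τ : Icc (0 : ℝ) 1 => J ⟨b τ, hbmem τ τ.2⟩ := by
      funext τ
      simp only [domRestrict_apply, ha, dif_pos (hbmem τ τ.2)]
    rw [h1]
    exact hJc.comp (hbc.subtype_mk _)
  have hab : ∀ τ ∈ Icc (0 : ℝ) 1, D.ι (a τ) = b τ := fun τ hτ => by
    simp only [ha, dif_pos (hbmem τ hτ)]
    exact hJ _
  obtain ⟨M, hM⟩ := isCompact_Icc.exists_bound_of_continuousOn hac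
  have hseg : D.IsSegment (fstSeminorm V (H →L[𝕜] H)) M 0 1 p fun τ => D.pt (a τ) :=
    { cont_path := hpc
      cont_control := by
        refine hac.prodMk (hbc.congr fun τ hτ => hab τ hτ)
      mem := fun τ _ => D.pt_mem _
      bound := hM
      deriv := fun τ hτ => by
        refine (hpder τ ⟨hτ.1.le, hτ.2.le⟩).congr_deriv ?_
        rw [pt_snd, hab τ ⟨hτ.1.le, hτ.2.le⟩, Units.mul_inv_cancel_left] }
  have hreach := Reach.seg zero_le_one hseg
  have hp0 : p 0 = 1 := by
    simp only [hp, hline, zero_smul, add_zero]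
    rw [φ.left_inv (mem_extChartAt_source 1)]
    rfl
  have hp1 : p 1 = x := by
    simp only [hp, hline, hu, one_smul, add_sub_cancel]
    rw [φ.left_inv hx]
  rw [hp0, hp1, inv_one, one_mul] at hreach
  exact ⟨_, hreach⟩

/-- The reachable elements form a subgroup that is a neighbourhood of `1` in the Lie group topology,
hence open and closed, hence everything by connectedness. -/
theorem exists_reach (hι : Function.Injective D.ι) (hsub : ∀ X ∈ K.lieAlgebra, ∃ v, D.ι v = X)
    (x : (H →L[𝕜] H)ˣ) (hx : x ∈ K.carrier) :
    ∃ ρ, D.Reach (fstSeminorm V (H →L[𝕜] H)) x ρ := by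
  have : IsTopologicalGroup K.carrier := topologicalGroup_of_lieGroup (𝓡 K.dim) ∞
  set U : Subgroup K.carrier :=
    { carrier := {x | ∃ ρ, D.Reach (fstSeminorm V (H →L[𝕜] H)) (x : (H →L[𝕜] H)ˣ) ρ}
      mul_mem' := fun ⟨ρ, h⟩ ⟨ρ', h'⟩ => ⟨ρ + ρ', h.mul h'⟩
      one_mem' := ⟨0, reach_one le_rfl⟩
      inv_mem' := fun ⟨ρ, h⟩ => ⟨ρ, h.inv⟩ } with hU
  have hopen : IsOpen (U : Set K.carrier) :=
    U.isOpen_of_mem_nhds (K.eventually_reach D hι hsub)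
  have huniv : (U : Set K.carrier) = univ :=
    IsClopen.eq_univ ⟨U.isClosed_of_isOpen hopen, hopen⟩ ⟨1, U.one_mem⟩
  exact (huniv ▸ mem_univ (⟨x, hx⟩ : K.carrier) : (⟨x, hx⟩ : K.carrier) ∈ (U : Set K.carrier))

end ConnectedLieSubgroup

/-! ### The distance compared with reachability -/

section CameronMartinDistance

open LieRealization

variable {𝕜 : Type*} [RCLike 𝕜] {H : Type*} [NormedAddCommGroup H]
  [InnerProductSpace 𝕜 H] [NormedSpace ℝ H] [IsScalarTower ℝ 𝕜 H] [CompleteSpace H]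
  {V : Type*} [NormedAddCommGroup V] [InnerProductSpace ℝ V] [CompleteSpace V]

/-- Injectivity makes the bracket in `V` unique, and so bilinear. -/
theorem exists_lieRealization {ι : V →ₗ[ℝ] (H →L[𝕜] H)} (hι : Function.Injective ι) {C : ℝ}
    (hC : 0 < C) (h_bracket : ∀ x y : V, ∃ z : V, ι z = ⁅ι x, ι y⁆ ∧ ‖z‖ ≤ C * ‖x‖ * ‖y‖) :
    ∃ D : LieRealization V (H →L[𝕜] H), D.ι = ι := by
  choose β hβ hβC using h_bracket
  have hβ' : ∀ x y, ι (β x y) = ι x * ι y - ι y * ι x := fun x y => by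
    rw [hβ, Ring.lie_def]
  refine ⟨{ ι := ι
            ad :=
              { toFun := fun x => LinearMap.mkContinuous
                  { toFun := β x
                    map_add' := fun y z => hι ?_
                    map_smul' := fun r y => hι ?_ } (C * ‖x‖) (hβC x)
                map_add' := fun x y => ContinuousLinearMap.ext fun z => hι ?_
                map_smul' := fun r x => ContinuousLinearMap.ext fun z => hι ?_ }
            C := C
            C_nonneg := hC.le
            ι_ad := hβ'
            norm_ad_le := hβC }, rfl⟩
  · simp only [map_add, hβ', mul_add, add_mul]
    abel
  · simp only [map_smul, hβ', RingHom.id_apply, smul_sub, mul_smul_comm, smul_mul_assoc]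
  · change ι (β (x + y) z) = ι (β x z + β y z)
    simp only [map_add, hβ', mul_add, add_mul]
    abel
  · change ι (β (r • x) z) = ι (r • β x z)
    simp only [map_smul, hβ', smul_sub, mul_smul_comm, smul_mul_assoc]

variable (D : LieRealization V (H →L[𝕜] H))

theorem reach_of_cmDist_lt {y z : (H →L[𝕜] H)ˣ} {ρ : ℝ}
    (h : cmDist D.ι y z < ENNReal.ofReal ρ) :
    D.Reach (fstSeminorm V (H →L[𝕜] H)) (y⁻¹ * z) ρ := by
  simp only [cmDist, iInf_lt_iff] at h
  obtain ⟨g, A, ⟨hg, rfl, rfl⟩, hlt⟩ := h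
  obtain ⟨S, dg, h1, h2, h3, h4⟩ := hg.exists_deriv
  refine reach_of_path (S := S) (a := A) hg.continuousOn (fun τ hτ hS => ?_)
    (piecewiseContinuous_pt hg.continuousOn h2 h3 h4) hlt
  refine (h1 τ hτ hS).congr_deriv ?_
  rw [h3 τ hτ hS, Units.mul_inv_cancel_left]

theorem cmDist_le_of_hasPath {y z : (H →L[𝕜] H)ˣ} {ℓ : ℝ} (h : D.HasPath (y⁻¹ * z) ℓ) :
    cmDist D.ι y z ≤ ENNReal.ofReal ℓ := by
  obtain ⟨g, a, h1, h2, h3, h4, h5, h6⟩ := h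
  refine le_trans (iInf_le_of_le (fun τ => y * g τ) (iInf_le_of_le a (iInf_le _ ?_))) h6
  have hc : ContinuousOn (fun τ => ((y * g τ : (H →L[𝕜] H)ˣ) : H →L[𝕜] H)) (Icc 0 1) :=
    continuousOn_const.mul h1
  have hd : ∀ τ ∈ Icc (0 : ℝ) 1, τ ∉ ({1} : Finset ℝ) →
      HasDerivWithinAt (fun τ => ((y * g τ : (H →L[𝕜] H)ˣ) : H →L[𝕜] H))
        (((y * g τ : (H →L[𝕜] H)ˣ) : H →L[𝕜] H) * D.ι (a τ)) (Icc 0 1) τ := by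
    intro τ hτ hS
    simp only [Units.val_mul]
    refine ((h4 τ hτ hS).const_mul (y : H →L[𝕜] H)).congr_deriv ?_
    rw [mul_assoc]
  refine ⟨⟨hc, {1}, fun τ => ((y * g τ : (H →L[𝕜] H)ˣ) : H →L[𝕜] H) * D.ι (a τ), hd, ?_,
    fun τ _ _ => (Units.inv_mul_cancel_left _ _).symm, h5.comp_continuous continuous_fst⟩,
    by simp only [h2, mul_one], by simp only [h3, mul_inv_cancel_left]⟩
  have hι := h5.comp_continuous continuous_snd
  refine ⟨fun τ hτ hS => (hc τ hτ).mul (hι.1 τ hτ hS), fun τ hτ => ?_, fun τ hτ => ?_⟩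
  · obtain ⟨l, hl⟩ := hι.2.1 τ hτ
    have hle : 𝓝[<] τ ≤ 𝓝[Icc 0 1] τ := by
      rw [← nhdsWithin_Ioo_eq_nhdsLT hτ.1]
      exact nhdsWithin_mono _ fun x hx => ⟨hx.1.le, hx.2.le.trans hτ.2⟩
    exact ⟨_, ((hc τ ⟨hτ.1.le, hτ.2⟩).mono_left hle).mul hl⟩
  · obtain ⟨l, hl⟩ := hι.2.2 τ hτ
    have hle : 𝓝[>] τ ≤ 𝓝[Icc 0 1] τ := by
      rw [← nhdsWithin_Ioo_eq_nhdsGT hτ.2]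
      exact nhdsWithin_mono _ fun x hx => ⟨hτ.1.trans hx.1.le, hx.2.le⟩
    exact ⟨_, ((hc τ ⟨hτ.1, hτ.2.le⟩).mono_left hle).mul hl⟩

/-- Together with `reach_of_cmDist_lt` this shows that distance and `V`-cost define the same small
neighbourhoods; a constant factor is all that density and completeness can tolerate and all they
need. -/
theorem exists_cmDist_le_of_reach :
    ∃ K : ℝ, 0 ≤ K ∧ ∀ (y z : (H →L[𝕜] H)ˣ) (ρ : ℝ), 0 < ρ →
      D.Reach (fstSeminorm V (H →L[𝕜] H)) (y⁻¹ * z) ρ →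
      cmDist D.ι y z ≤ ENNReal.ofReal (K * ρ) := by
  obtain ⟨K, hK, h⟩ := Reach.exists_hasPath D
  refine ⟨K * 2, by positivity, fun y z ρ hρ hr => ?_⟩
  exact cmDist_le_of_hasPath D ((h _ ρ hr ρ hρ).mono (by linarith))

theorem exists_reach_of_mem_cameronMartinGroup {x : (H →L[𝕜] H)ˣ}
    (hx : x ∈ cameronMartinGroup D.ι) : ∃ ρ, D.Reach (fstSeminorm V (H →L[𝕜] H)) x ρ := by
  obtain ⟨r, hr, -⟩ := ENNReal.lt_iff_exists_nnreal_btwn.1 (show cmDist D.ι x 1 < ⊤ from hx)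
  rw [← ENNReal.ofReal_coe_nnreal] at hr
  have h := (reach_of_cmDist_lt D hr).inv
  rw [mul_one, inv_inv] at h
  exact ⟨_, h⟩

theorem mem_cameronMartinGroup_of_reach {x : (H →L[𝕜] H)ˣ} {ρ : ℝ}
    (hx : D.Reach (fstSeminorm V (H →L[𝕜] H)) x ρ) : x ∈ cameronMartinGroup D.ι := by
  obtain ⟨K, -, h⟩ := exists_cmDist_le_of_reach D
  have h1 := h x 1 (max ρ 1) (lt_max_of_lt_right one_pos)
    (by rw [mul_one]; exact hx.inv.mono (le_max_left _ _))
  exact h1.trans_lt ENNReal.ofReal_lt_top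

theorem cmDist_lt_of_forall_reach :
    ∀ ε : ℝ≥0∞, 0 < ε → ∃ δ : ℝ, 0 < δ ∧ ∀ y z : (H →L[𝕜] H)ˣ,
      D.Reach (fstSeminorm V (H →L[𝕜] H)) (y⁻¹ * z) δ → cmDist D.ι y z < ε := by
  obtain ⟨K, hK, h⟩ := exists_cmDist_le_of_reach D
  intro ε hε
  obtain ⟨r, hr0, hr⟩ := ENNReal.lt_iff_exists_nnreal_btwn.1 hε
  rw [← ENNReal.ofReal_coe_nnreal] at hr0 hr
  have hr0' : (0 : ℝ) < r := ENNReal.ofReal_pos.1 hr0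
  refine ⟨r / (K + 1), by positivity, fun y z hyz => (h y z _ (by positivity) hyz).trans_lt
    ((ENNReal.ofReal_le_ofReal ?_).trans_lt hr)⟩
  rw [mul_div_assoc', div_le_iff₀ (by positivity)]
  nlinarith

theorem dense_of_dense_lieAlgebra (G : ℕ → ConnectedLieSubgroup 𝕜 H)
    (hG : Monotone fun n => (G n).carrier)
    (h_dense : Dense {v : V | ∃ n, D.ι v ∈ (G n).lieAlgebra}) {x : (H →L[𝕜] H)ˣ} {ρ : ℝ}
    (hx : D.Reach (fstSeminorm V (H →L[𝕜] H)) x ρ) {δ : ℝ} (hδ : 0 < δ) :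
    ∃ y ∈ ⋃ n, ((G n).carrier : Set (H →L[𝕜] H)ˣ),
      D.Reach (fstSeminorm V (H →L[𝕜] H)) (y⁻¹ * x) δ := by
  -- Only `V`-closeness to the control is required, which is exactly what density in `V` provides.
  obtain ⟨σ, -, h⟩ := hx.inv.exists_prodExp D.adBounded_fst
    (P := fun v => ∃ n, D.ι v ∈ (G n).lieAlgebra) (f := fun v => ‖v‖)
    (fun r _ v ⟨n, hn⟩ => ⟨n, by rw [map_smul]; exact (G n).lieAlgebra.smul_mem r hn⟩)
    (fun r hr v => by rw [norm_smul, Real.norm_of_nonneg hr])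
    (fun c _ η hη => by
      obtain ⟨v, hv, hvη⟩ := Metric.mem_closure_iff.1 (h_dense c.1) η hη
      rw [dist_eq_norm] at hvη
      have h2 := norm_le_norm_add_norm_sub' v c.1
      rw [norm_sub_rev] at h2
      exact ⟨v, hv, hvη.le, h2.trans (add_le_add_right hvη.le _)⟩)
  obtain ⟨l, hl, -, -, hr⟩ := h δ hδ
  have hmem : ∃ n, D.prodExp l ∈ (G n).carrier := by
    clear hr
    induction l with
    | nil => exact ⟨0, one_mem _⟩
    | cons v l ih =>
      obtain ⟨n, hn⟩ := ih fun w hw => hl w (List.mem_cons_of_mem _ hw)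
      obtain ⟨m, hm⟩ := hl v List.mem_cons_self
      refine ⟨max m n, ?_⟩
      rw [prodExp_cons]
      exact mul_mem (hG (le_max_left m n) ((G m).expUnit_mem hm)) (hG (le_max_right m n) hn)
  obtain ⟨n, hn⟩ := hmem
  refine ⟨(D.prodExp l)⁻¹, mem_iUnion.2 ⟨n, inv_mem hn⟩, ?_⟩
  have := hr.inv
  rw [mul_inv_rev, inv_inv, inv_inv] at this
  rwa [inv_inv]

theorem complete_cmDist {u : ℕ → (H →L[𝕜] H)ˣ} (hu : ∀ n, u n ∈ cameronMartinGroup D.ι)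
    (hcauchy : ∀ ε : ℝ≥0∞, 0 < ε → ∃ N, ∀ m ≥ N, ∀ n ≥ N, cmDist D.ι (u m) (u n) < ε) :
    ∃ x ∈ cameronMartinGroup D.ι, Tendsto (fun n => cmDist D.ι (u n) x) atTop (𝓝 0) := by
  have hc : ∀ δ : ℝ, 0 < δ → ∃ N, ∀ m ≥ N, ∀ n ≥ N,
      D.Reach (fstSeminorm V (H →L[𝕜] H)) ((u m)⁻¹ * u n) δ := fun δ hδ =>
    (hcauchy (ENNReal.ofReal δ) (ENNReal.ofReal_pos.2 hδ)).imp fun N hN m hm n hn =>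
      reach_of_cmDist_lt D (hN m hm n hn)
  choose! N hN using hc
  -- A subsequence with geometrically decreasing increments; running maxima make the indices
  -- monotone.
  obtain ⟨φ, hφ, hφN⟩ : ∃ φ : ℕ → ℕ, Monotone φ ∧ ∀ k, N ((1 / 2) ^ k) ≤ φ k :=
    ⟨fun k => (Finset.range (k + 1)).sup fun i => N ((1 / 2) ^ i),
      fun a b hab => Finset.sup_mono (Finset.range_mono (by omega)),
      fun k => Finset.le_sup (f := fun i => N ((1 / 2) ^ i)) (Finset.self_mem_range_succ k)⟩
  obtain ⟨x, hx⟩ := exists_limit D (u := fun k => u (φ k)) fun k =>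
    hN _ (by positivity) _ (hφN k) _ ((hφN k).trans (hφ k.le_succ))
  have hlim : ∀ δ : ℝ, 0 < δ → ∀ᶠ n in atTop,
      D.Reach (fstSeminorm V (H →L[𝕜] H)) ((u n)⁻¹ * x) δ := by
    intro δ hδ
    have hpow : Tendsto (fun k : ℕ => ((1 : ℝ) / 2) ^ k) atTop (𝓝 0) :=
      tendsto_pow_atTop_nhds_zero_of_lt_one (by norm_num) (by norm_num)
    obtain ⟨k, hk1, hk2⟩ := ((hx (δ / 2) (half_pos hδ)).and
      (hpow.eventually (gt_mem_nhds (half_pos hδ)))).exists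
    filter_upwards [eventually_ge_atTop (N ((1 / 2) ^ k))] with n hn
    have h1 := ((hN _ (by positivity) n hn (φ k) (hφN k)).mono hk2.le).mul hk1
    rwa [add_halves, mul_assoc, mul_inv_cancel_left] at h1
  refine ⟨x, ?_, ?_⟩
  · obtain ⟨n, hn⟩ := (hlim 1 one_pos).exists
    obtain ⟨ρ, hρ⟩ := exists_reach_of_mem_cameronMartinGroup D (hu n)
    have := hρ.mul hn
    rw [mul_inv_cancel_left] at this
    exact mem_cameronMartinGroup_of_reach D this
  · rw [ENNReal.tendsto_nhds_zero]
    intro ε hε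
    obtain ⟨δ, hδ, h⟩ := cmDist_lt_of_forall_reach D ε hε
    filter_upwards [hlim δ hδ] with n hn using (h _ _ hn).le

end CameronMartinDistance

end OperatorAlgebra

theorem theorem3p2 {𝕜 : Type*} [RCLike 𝕜] {H : Type*} [NormedAddCommGroup H]
    [InnerProductSpace 𝕜 H] [NormedSpace ℝ H] [IsScalarTower ℝ 𝕜 H] [CompleteSpace H]
    [TopologicalSpace.SeparableSpace H]
    -- an increasing sequence of connected finite-dimensional Lie subgroups of `GL(H)`
    (G : ℕ → ConnectedLieSubgroup 𝕜 H) (hG : Monotone fun n => (G n).carrier)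
    -- the Hilbert space `𝔤_∞ ⊆ B(H)`, in which the union of the Lie algebras is dense
    {V : Type*} [NormedAddCommGroup V] [InnerProductSpace ℝ V] [CompleteSpace V]
    (ι : V →ₗ[ℝ] (H →L[𝕜] H)) (hι : Function.Injective ι)
    (h_sub : ∀ n, (G n).lieAlgebra ≤ LinearMap.range ι)
    (h_dense : Dense {v : V | ∃ n, ι v ∈ (G n).lieAlgebra})
    -- `𝔤_∞` is closed under the commutator bracket, which is continuous in the norm of `𝔤_∞`
    (C : ℝ) (hC : 0 < C)
    (h_bracket : ∀ x y : V, ∃ z : V, ι z = ⁅ι x, ι y⁆ ∧ ‖z‖ ≤ C * ‖x‖ * ‖y‖) :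
    -- `G_∞` is a dense subset of `G_CM`
    ((⋃ n, ((G n).carrier : Set (H →L[𝕜] H)ˣ)) ⊆ cameronMartinGroup ι ∧
      ∀ x ∈ cameronMartinGroup ι, ∀ ε : ℝ≥0∞, 0 < ε →
        ∃ y ∈ ⋃ n, ((G n).carrier : Set (H →L[𝕜] H)ˣ), cmDist ι y x < ε) ∧
    -- every Cauchy sequence in `G_CM` converges in `G_CM`
    ∀ u : ℕ → (H →L[𝕜] H)ˣ, (∀ n, u n ∈ cameronMartinGroup ι) →
      (∀ ε : ℝ≥0∞, 0 < ε → ∃ N, ∀ m ≥ N, ∀ n ≥ N, cmDist ι (u m) (u n) < ε) →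
      ∃ x ∈ cameronMartinGroup ι, Tendsto (fun n => cmDist ι (u n) x) atTop (𝓝 0) := by
  obtain ⟨D, rfl⟩ := exists_lieRealization hι hC h_bracket
  refine ⟨⟨fun x hx => ?_, fun x hx ε hε => ?_⟩, fun u hu hc => complete_cmDist D hu hc⟩
  · obtain ⟨n, hn⟩ := mem_iUnion.1 hx
    obtain ⟨ρ, hρ⟩ := (G n).exists_reach D hι (fun X hX => h_sub n hX) x hn
    exact mem_cameronMartinGroup_of_reach D hρ
  · obtain ⟨ρ, hρ⟩ := exists_reach_of_mem_cameronMartinGroup D hx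
    obtain ⟨δ, hδ, h⟩ := cmDist_lt_of_forall_reach D ε hε
    obtain ⟨y, hy, hr⟩ := dense_of_dense_lieAlgebra D G hG h_dense hρ hδ
    exact ⟨y, hy, h y x hr⟩
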